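/- Let $b>a>0$. For $g$ on $\mathbb{R}^2$ write $\hat g(\xi)=\mathcal F g(\xi)=\frac1{2\pi}\int_{\mathbb{R}^2}e^{-ix\cdot\xi}g(x)\,dx$, let $\mathcal F^{-1}$ be the inverse transform, and let $m(D)$ be the operator with symbol $m(\xi)$, $m(D)\mathcal F^{-1}h=\mathcal F^{-1}(mh)$; in particular $|D|^s$ has symbol $|\xi|^s$, and $\|g\|_{\dot H^s_q(\mathbb{R}^2)}=\||D|^sg\|_{L^q(\mathbb{R}^2)}$. Consider the linear elastic waves with Kelvin–Voigt damping $$u_{tt}-a^2\Delta u-(b^2-a^2)\nabla\operatorname{div}u+\left(-a^2\Delta-(b^2-a^2)\nabla\operatorname{div}\right)u_t=0,\quad (u,u_t)(0,x)=(u_0,u_1)(x),\quad t>0,\ x\in\mathbb{R}^2,$$ with $u=(u^{(1)},u^{(2)})^{\mathrm T}$. Let the data satisfy $(|D|u_0^{(k)},u_1^{(k)})\in\mathcal S(\mathbb{R}^2)\times\mathcal S(\mathbb{R}^2)$ for $k=1,2$, where $u_0^{(k)}$ is a tempered distribution whose Fourier transform is a locally integrable function. For $\xi\ne0$ put $\eta=\xi/|\xi|$,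 $$M(\eta)=\begin{pmatrix}\eta_1&\eta_2\\ \eta_2&-\eta_1\end{pmatrix},\qquad v_j(\xi)=M(\eta)^{-1}\hat u_j(\xi)\ (j=0,1),\qquad W_0(\xi)=\begin{pmatrix}v_1+i|\xi|\operatorname{diag}(b,a)v_0\\ v_1-i|\xi|\operatorname{diag}(b,a)v_0\end{pmatrix}\in\mathbb{C}^4 ,$$ and let $W=W(t,\xi)$ be the solution of $$W_t+\tfrac12|\xi|^2B_0W-i|\xi|B_1W=0\quad(t>0),\qquad W(0,\xi)=W_0(\xi),$$ $$B_0=\begin{pmatrix}b^2&0&b^2&0\\0&a^2&0&a^2\\b^2&0&b^2&0\\0&a^2&0&a^2\end{pmatrix},\qquad B_1=\operatorname{diag}(b,a,-b,-a).$$ Let $$\hat S_0(t,\xi)=\operatorname{diag}\left(e^{ib|\xi|t-\frac{b^2}{2}|\xi|^2t},e^{ia|\xi|t-\frac{a^2}{2}|\xi|^2t},e^{-ib|\xi|t-\frac{b^2}{2}|\xi|^2t},e^{-ia|\xi|t-\frac{a^2}{2}|\xi|^2t}\right).$$ Let $\varepsilon>0$ and let $\chi_{\mathrm{int}}\in C^\infty(\mathbb{R}^2;\mathbb{R})$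 vanish outside $\{|\xi|<\varepsilon\}$. Let $s\ge0$, $1\le p\le2$ and $\frac1p+\frac1q=1$ (so $q=\infty$ if $p=1$). Then there is a constant $C>0$, depending only on $a,b,\chi_{\mathrm{int}},s,p$, such that for all such data and all $t\ge0$ the functions $\chi_{\mathrm{int}}(W-\hat S_0W_0)(t,\cdot)$ and $|\xi|^s\chi_{\mathrm{int}}(W-\hat S_0W_0)(t,\cdot)$ are integrable on $\mathbb{R}^2$ and $$\left\|\chi_{\mathrm{int}}(D)\mathcal F^{-1}_{\xi\to x}(W-\hat S_0W_0)(t,\cdot)\right\|_{\dot H^s_q(\mathbb{R}^2)}\le C(1+t)^{-\frac12\left(s+2\left(\frac1p-\frac1q\right)\right)-\frac12}\sum_{k=1}^2\left(\||D|u_0^{(k)}\|_{L^p(\mathbb{R}^2)}+\|u_1^{(k)}\|_{L^p(\mathbb{R}^2)}\right).$$ -/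

import Mathlib

open scoped ContDiff SchwartzMap FourierTransform ENNReal

noncomputable section

namespace KelvinVoigt

open MeasureTheory Complex

/-- The plane `ℝ²` with its Euclidean norm. -/
abbrev Plane : Type := EuclideanSpace ℝ (Fin 2)

/-- The space `ℂ⁴` with its Euclidean norm. -/
abbrev C4 : Type := EuclideanSpace ℂ (Fin 4)

section Fourier

variable {V : Type*} [NormedAddCommGroup V] [NormedSpace ℂ V]

/-- The unitary Fourier transform on `ℝ²` in angular frequency,
`ĝ(ξ) = (2π)⁻¹ ∫ e^{-i x·ξ} g(x) dx`, so that `-Δ` has the symbol `|ξ|²`.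
(Mathlib's `𝓕` has the kernel `e^{-2πi x·ξ}`.) -/
def fourier (g : Plane → V) (ξ : Plane) : V :=
  ((2 * Real.pi : ℝ) : ℂ)⁻¹ • 𝓕 g ((2 * Real.pi)⁻¹ • ξ)

/-- The inverse Fourier transform `ȟ(x) = (2π)⁻¹ ∫ e^{i x·ξ} h(ξ) dξ`. -/
def fourierInv (h : Plane → V) (x : Plane) : V :=
  ((2 * Real.pi : ℝ) : ℂ)⁻¹ • 𝓕⁻ h ((2 * Real.pi)⁻¹ • x)

theorem fourier_eq (g : Plane → V) (ξ : Plane) :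
    fourier g ξ = ((2 * Real.pi : ℝ) : ℂ)⁻¹ •
      ∫ x : Plane, cexp (-(I * (inner ℝ x ξ : ℝ))) • g x := by
  unfold fourier
  rw [Real.fourier_eq']
  congr 2
  funext x
  congr 2
  rw [inner_smul_right]
  push_cast
  have : (Real.pi : ℂ) ≠ 0 := by exact_mod_cast Real.pi_ne_zero
  field_simp

theorem fourierInv_eq (h : Plane → V) (x : Plane) :
    fourierInv h x = ((2 * Real.pi : ℝ) : ℂ)⁻¹ •
      ∫ ξ : Plane, cexp (I * (inner ℝ ξ x : ℝ)) • h ξ := by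
  unfold fourierInv
  rw [Real.fourierInv_eq']
  congr 2
  funext ξ
  congr 2
  rw [inner_smul_right]
  push_cast
  have : (Real.pi : ℂ) ≠ 0 := by exact_mod_cast Real.pi_ne_zero
  field_simp

/-- `‖F⁻¹ h‖` in the Riesz potential space `Ḣ^s_q(ℝ²)`, that is,
`‖ |D|^s F⁻¹ h ‖_{L^q} = ‖ F⁻¹(|ξ|^s h) ‖_{L^q}`. -/
def rieszNormInv (s : ℝ) (q : ℝ≥0∞) (h : Plane → V) : ℝ≥0∞ :=
  eLpNorm (fourierInv fun ξ => ‖ξ‖ ^ s • h ξ) q volume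

end Fourier

/-- The Fourier transform of the tempered distribution `u` is the function `h`:
`⟨u, φ⟩ = ∫ h(ξ) φ̌(ξ) dξ` for all Schwartz functions `φ`. -/
def HasFourierTransform (u : 𝓢'(Plane, ℂ)) (h : Plane → ℂ) : Prop :=
  LocallyIntegrable h ∧
    ∀ φ : 𝓢(Plane, ℂ), Integrable (fun ξ => h ξ * fourierInv (⇑φ) ξ) ∧
      u φ = ∫ ξ, h ξ * fourierInv (⇑φ) ξ

/-- `|D| u = f` for a tempered distribution `u` with Fourier transform the function `h`:
`|ξ| h(ξ) = f̂(ξ)` almost everywhere. -/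
def IsAbsD (u : 𝓢'(Plane, ℂ)) (h : Plane → ℂ) (f : 𝓢(Plane, ℂ)) : Prop :=
  HasFourierTransform u h ∧ ∀ᵐ ξ : Plane, (‖ξ‖ : ℂ) * h ξ = fourier (⇑f) ξ

/-- The matrix `M(η)`. -/
def M (η : Plane) : Matrix (Fin 2) (Fin 2) ℂ :=
  !![(η 0 : ℂ), (η 1 : ℂ); (η 1 : ℂ), -(η 0 : ℂ)]

/-- `M(η)⁻¹ z` at `η = ξ/|ξ|`. -/
def changeVar (z : Fin 2 → ℂ) (ξ : Plane) : Fin 2 → ℂ :=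
  ((M (‖ξ‖⁻¹ • ξ))⁻¹).mulVec z

/-- The data `W₀ = (v₁ + i A_diag^{1/2} v₀, v₁ - i A_diag^{1/2} v₀)`, where
`A_diag^{1/2}(|ξ|) = |ξ| diag(b, a)` and `v_j = M⁻¹(η) û_j`. -/
def W0 (a b : ℝ) (uhat0 uhat1 : Fin 2 → Plane → ℂ) (ξ : Plane) : C4 :=
  let v0 := changeVar (fun k => uhat0 k ξ) ξ
  let v1 := changeVar (fun k => uhat1 k ξ) ξ
  !₂[v1 0 + I * (b * ‖ξ‖) * v0 0,
     v1 1 + I * (a * ‖ξ‖) * v0 1,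
     v1 0 - I * (b * ‖ξ‖) * v0 0,
     v1 1 - I * (a * ‖ξ‖) * v0 1]

def B0 (a b : ℝ) : Matrix (Fin 4) (Fin 4) ℂ :=
  !![(b : ℂ) ^ 2, 0, (b : ℂ) ^ 2, 0;
     0, (a : ℂ) ^ 2, 0, (a : ℂ) ^ 2;
     (b : ℂ) ^ 2, 0, (b : ℂ) ^ 2, 0;
     0, (a : ℂ) ^ 2, 0, (a : ℂ) ^ 2]

def B1 (a b : ℝ) : Matrix (Fin 4) (Fin 4) ℂ :=
  Matrix.diagonal ![(b : ℂ), (a : ℂ), -(b : ℂ), -(a : ℂ)]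

/-- A matrix acting on `ℂ⁴`. -/
def act (A : Matrix (Fin 4) (Fin 4) ℂ) (w : C4) : C4 :=
  WithLp.toLp 2 (A.mulVec w.ofLp)

/-- `W` solves, for almost every frequency `ξ`, the Cauchy problem
`W_t + ½ |ξ|² B₀ W - i |ξ| B₁ W = 0` for `t > 0`, `W(0, ξ) = Winit(ξ)`. -/
def IsSolution (a b : ℝ) (Winit : Plane → C4) (W : ℝ → Plane → C4) : Prop :=
  ∀ᵐ ξ : Plane, W 0 ξ = Winit ξ ∧ ContinuousOn (fun t => W t ξ) (Set.Ici 0) ∧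
    ∀ t : ℝ, 0 < t → ∃ W' : C4, HasDerivAt (fun τ => W τ ξ) W' t ∧
      W' + ((1 / 2 : ℂ) * (‖ξ‖ : ℂ) ^ 2) • act (B0 a b) (W t ξ)
        - (I * (‖ξ‖ : ℂ)) • act (B1 a b) (W t ξ) = 0

/-- The diagonal matrix `Ŝ₀(t, ξ)`. -/
def S0 (a b t : ℝ) (ξ : Plane) : Matrix (Fin 4) (Fin 4) ℂ :=
  Matrix.diagonal
    ![cexp ((I * b * ‖ξ‖ - b ^ 2 / 2 * (‖ξ‖ : ℂ) ^ 2) * t),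
      cexp ((I * a * ‖ξ‖ - a ^ 2 / 2 * (‖ξ‖ : ℂ) ^ 2) * t),
      cexp ((-(I * b * ‖ξ‖) - b ^ 2 / 2 * (‖ξ‖ : ℂ) ^ 2) * t),
      cexp ((-(I * a * ‖ξ‖) - a ^ 2 / 2 * (‖ξ‖ : ℂ) ^ 2) * t)]

/-- The Fourier transform `χ (W - Ŝ₀ W₀)(t, ·)` of the low-frequency part
`χ(D) F⁻¹(W - Ŝ₀ W₀)(t, ·)`. -/
def lowFreqDiff (a b : ℝ) (χ : Plane → ℝ) (Winit : Plane → C4) (W : ℝ → Plane → C4)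
    (t : ℝ) (ξ : Plane) : C4 :=
  χ ξ • (W t ξ - act (S0 a b t ξ) (Winit ξ))

end KelvinVoigt

end

/-! At a fixed frequency the system splits into two pairs of half-waves, one of speed `b` and one of
speed `a`. With `ρ = c|ξ|`, the two components of a pair oscillate like `e^{±iρt}` and are coupled
at order `ρ²`. The frequency gap `2ρ` makes this coupling non-resonant: passing to `w + (iρ/4) z`
removes it and leaves an error of order `ρ³` (`IsHalfWavePair.norm_sub_le`). A Lyapunov functional
gives both components the decay `e^{-κρ²t}`, and Duhamel's formula turns the error into `|ρ|³ t
e^{-κρ²t}`, which is at most a constant times `|ρ|` times a weaker Gaussian. So `Ŝ₀` approximates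
the propagator up to `O(|ξ| e^{-κ|ξ|²t})`, and this factor `|ξ|` is the source of the extra
`(1+t)^{-1/2}`.

The weighted symbol is therefore `O((1+t)^{-(s+1)/2})` in `L^∞` and, by the planar Gaussian
integral, smaller by a further `(1+t)^{-1}` in `L¹` (`exists_diffSymbol_le`). An integrable symbol
maps `L¹` to `L^∞`, a bounded one maps `L²` to `L²`, and interpolation gives `L^p → L^q` with the
`L¹` bound raised to `d = 1/p - 1/q` and the sup bound to `1 - d` (`exists_eLpNorm_multiplier_le`).
Only the size of the symbol enters, so neither its oscillation nor the discontinuity of `ξ/|ξ|` at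
the origin does any harm. -/

namespace KelvinVoigt

open MeasureTheory Complex

/-! ### Plancherel's theorem for Fourier integrals on `L¹ ∩ L²`. -/

section Plancherel

variable {E F : Type*} [NormedAddCommGroup E] [MeasurableSpace E] [BorelSpace E]
  [InnerProductSpace ℝ E] [FiniteDimensional ℝ E]
  [NormedAddCommGroup F] [InnerProductSpace ℂ F]

theorem continuous_fourier_of_integrable {f : E → F} (hf : Integrable f) : Continuous (𝓕 f) :=
  VectorFourier.fourierIntegral_continuous Real.continuous_fourierChar
    (by exact continuous_inner) hf

/-- On `L¹ ∩ L²`, the Fourier integral represents the `L²` Fourier transform. -/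
theorem fourier_toLp_ae_eq [CompleteSpace F] {f : E → F} (h1 : Integrable f) (h2 : MemLp f 2) :
    𝓕 f =ᵐ[volume] (𝓕 (h2.toLp f) : Lp (α := E) F 2) := by
  -- Both sides are locally integrable, so it suffices to test against smooth compactly supported
  -- functions; there, both pairings move the transform onto the test function.
  refine ae_eq_of_integral_contDiff_smul_eq (continuous_fourier_of_integrable h1).locallyIntegrable
    ((Lp.memLp _).locallyIntegrable (by norm_num)) fun g hg hgc => ?_
  have hgc' : HasCompactSupport (fun x => (g x : ℂ)) := hgc.comp_left (g := ((↑) : ℝ → ℂ)) (by simp)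
  have hg' : ContDiff ℝ ∞ (fun x => (g x : ℂ)) := ofRealCLM.contDiff.comp hg
  let φ : 𝓢(E, ℂ) := hgc'.toSchwartzMap hg'
  have hφ : ∀ x, φ x = (g x : ℂ) := fun x => rfl
  have e1 : ∀ x (v : F), g x • v = φ x • v := fun x v => by rw [hφ, Complex.coe_smul]
  simp_rw [e1]
  have key := congrArg (fun T : 𝓢'(E, F) => T φ) (Lp.fourier_toTemperedDistribution_eq (h2.toLp f))
  simp only [TemperedDistribution.fourier_apply, Lp.toTemperedDistribution_apply] at key
  rw [← key]
  have : ∫ x, (𝓕 φ) x • (h2.toLp f) x = ∫ x, (𝓕 φ) x • f x := by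
    refine integral_congr_ae ?_
    filter_upwards [h2.coeFn_toLp] with x hx
    rw [hx]
  rw [this, SchwartzMap.fourier_coe]
  have h := (VectorFourier.integral_fourierIntegral_smul_eq_flip (L := innerₗ E)
    Real.continuous_fourierChar continuous_inner (SchwartzMap.integrable (μ := volume) φ) h1).symm
  rw [flip_innerₗ] at h
  exact h

/-- Plancherel's theorem for the Fourier integral on `L¹ ∩ L²`. -/
theorem eLpNorm_fourier_eq [CompleteSpace F] {f : E → F} (h1 : Integrable f) (h2 : MemLp f 2) :
    eLpNorm (𝓕 f) 2 volume = eLpNorm f 2 volume := by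
  have h := Lp.norm_fourier_eq (h2.toLp f)
  rw [eLpNorm_congr_ae (fourier_toLp_ae_eq h1 h2)]
  rw [Lp.norm_def, Lp.norm_toLp] at h
  exact (ENNReal.toReal_eq_toReal_iff' (Lp.eLpNorm_ne_top _) h2.2.ne).1 h

theorem eLpNorm_fourierInv_eq [CompleteSpace F] {f : E → F} (h1 : Integrable f) (h2 : MemLp f 2) :
    eLpNorm (𝓕⁻ f) 2 volume = eLpNorm f 2 volume := by
  have : 𝓕⁻ f = 𝓕 f ∘ Neg.neg := by
    funext x; simp [Real.fourierInv_eq_fourier_neg]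
  rw [this, eLpNorm_comp_measurePreserving
    (continuous_fourier_of_integrable h1).aestronglyMeasurable (Measure.measurePreserving_neg _),
    eLpNorm_fourier_eq h1 h2]

end Plancherel

/-- The `L²` norm on the plane under a positive dilation. -/
theorem eLpNorm_two_comp_smul {F : Type*} [NormedAddCommGroup F] (f : Plane → F) {c : ℝ}
    (hc : 0 < c) : eLpNorm (fun x => f (c • x)) 2 volume =
      ENNReal.ofReal c⁻¹ * eLpNorm f 2 volume := by
  have hm : MeasurableEmbedding (fun x : Plane => c • x) :=
    (Homeomorph.smulOfNeZero c hc.ne').measurableEmbedding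
  have h1 := hm.eLpNorm_map_measure (g := f) (p := 2) (μ := volume)
  have h2 : (volume : Measure Plane).map (fun x => c • x) = ENNReal.ofReal (c⁻¹ ^ 2) • volume := by
    have := Measure.map_addHaar_smul (volume : Measure Plane) hc.ne'
    rw [finrank_euclideanSpace_fin, abs_of_pos (by positivity), ← inv_pow] at this
    exact this
  rw [h2, eLpNorm_smul_measure_of_ne_top (by norm_num)] at h1
  change _ = eLpNorm (fun x => f (c • x)) 2 volume at h1
  rw [← h1, ENNReal.ofReal_pow (by positivity), smul_eq_mul, ← ENNReal.rpow_natCast,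
    ← ENNReal.rpow_mul]
  norm_num

/-! ### The transform normalised by `(2π)⁻¹` in angular frequency. -/

section PaperFourier

variable {V : Type*} [NormedAddCommGroup V] [InnerProductSpace ℂ V]

theorem continuous_fourier {g : Plane → V} (h : Integrable g) : Continuous (fourier g) :=
  ((continuous_fourier_of_integrable h).comp (continuous_const_smul _)).const_smul _

theorem two_pi_inv_norm_le : ‖((2 * Real.pi : ℝ) : ℂ)⁻¹‖ ≤ 1 := by
  rw [norm_inv, Complex.norm_real, Real.norm_of_nonneg (by positivity)]
  exact inv_le_one_of_one_le₀ (by linarith [Real.pi_gt_three])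

theorem norm_fourier_le (g : Plane → V) (ξ : Plane) : ‖fourier g ξ‖ ≤ ∫ x, ‖g x‖ := by
  rw [fourier_eq, norm_smul]
  refine (mul_le_of_le_one_left (norm_nonneg _) two_pi_inv_norm_le).trans ?_
  refine (norm_integral_le_integral_norm _).trans (le_of_eq ?_)
  congr 1; funext x
  rw [norm_smul, ← mul_neg, Complex.norm_exp]
  simp

theorem enorm_fourierInv_le (g : Plane → V) (x : Plane) : ‖fourierInv g x‖ₑ ≤ ∫⁻ ξ, ‖g ξ‖ₑ := by
  rw [fourierInv_eq, enorm_smul]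
  have h : ‖((2 * Real.pi : ℝ) : ℂ)⁻¹‖ₑ ≤ 1 := by
    rw [← ofReal_norm]
    exact ENNReal.ofReal_le_one.2 two_pi_inv_norm_le
  refine (mul_le_of_le_one_left' h).trans ?_
  refine (enorm_integral_le_lintegral_enorm _).trans (le_of_eq ?_)
  congr 1; funext x
  rw [enorm_smul, ← ofReal_norm, Complex.norm_exp]
  simp

theorem fourier_eq_fourierInv_neg (g : Plane → V) (x : Plane) :
    fourier g x = fourierInv g (-x) := by
  simp [fourierInv, fourier, Real.fourierInv_eq_fourier_neg]

theorem enorm_fourier_le (g : Plane → V) (x : Plane) : ‖fourier g x‖ₑ ≤ ∫⁻ ξ, ‖g ξ‖ₑ := by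
  rw [fourier_eq_fourierInv_neg]
  exact enorm_fourierInv_le g _

/-- In dimension two, dilation by `(2π)⁻¹` multiplies the `L²` norm by exactly `2π`, which the
prefactor cancels; hence the angular-frequency transform is unitary. -/
theorem eLpNorm_two_dilate (h : Plane → V) :
    eLpNorm (fun x => ((2 * Real.pi : ℝ) : ℂ)⁻¹ • h ((2 * Real.pi)⁻¹ • x)) 2 volume =
      eLpNorm h 2 volume := by
  have hpi : (0 : ℝ) < 2 * Real.pi := by positivity
  have := eLpNorm_const_smul (((2 * Real.pi : ℝ) : ℂ)⁻¹) (fun x => h ((2 * Real.pi)⁻¹ • x)) 2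
    (volume : Measure Plane)
  change eLpNorm (fun x => _) 2 volume = _ at this
  refine this.trans ?_
  rw [eLpNorm_two_comp_smul h (inv_pos.2 hpi), ← mul_assoc, ← ofReal_norm, norm_inv,
    Complex.norm_real, Real.norm_of_nonneg hpi.le, ← ENNReal.ofReal_mul (by positivity), inv_inv,
    inv_mul_cancel₀ hpi.ne', ENNReal.ofReal_one, one_mul]

theorem eLpNorm_two_fourier [CompleteSpace V] {g : Plane → V} (h1 : Integrable g) (h2 : MemLp g 2) :
    eLpNorm (fourier g) 2 volume = eLpNorm g 2 volume :=
  (eLpNorm_two_dilate (𝓕 g)).trans (eLpNorm_fourier_eq h1 h2)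

theorem eLpNorm_two_fourierInv [CompleteSpace V] {g : Plane → V} (h1 : Integrable g) (h2 : MemLp g 2) :
    eLpNorm (fourierInv g) 2 volume = eLpNorm g 2 volume :=
  (eLpNorm_two_dilate (𝓕⁻ g)).trans (eLpNorm_fourierInv_eq h1 h2)

theorem continuous_fourierInv {g : Plane → V} (h : Integrable g) : Continuous (fourierInv g) := by
  have : fourierInv g = fun x => fourier g (-x) := by
    funext x
    rw [fourier_eq_fourierInv_neg, neg_neg]
  rw [this]
  exact (continuous_fourier h).comp continuous_neg

theorem integrable_cexp_smul {g : Plane → V} (h : Integrable g) (x : Plane) :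
    Integrable fun ξ : Plane => cexp (I * (inner ℝ ξ x : ℝ)) • g ξ := by
  refine h.bdd_smul (C := 1) (Continuous.aestronglyMeasurable (by fun_prop)) (.of_forall fun ξ => ?_)
  simp [Complex.norm_exp]

theorem fourierInv_sum {ι : Type*} (S : Finset ι) (g : ι → Plane → V)
    (h : ∀ i ∈ S, Integrable (g i)) :
    fourierInv (fun ξ => ∑ i ∈ S, g i ξ) = fun x => ∑ i ∈ S, fourierInv (g i) x := by
  funext x
  simp only [fourierInv_eq, Finset.smul_sum]
  rw [integral_finsetSum _ fun i hi => integrable_cexp_smul (h i hi) x, Finset.smul_sum]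

theorem fourier_add {f g : Plane → V} (hf : Integrable f) (hg : Integrable g) (x : Plane) :
    fourier (f + g) x = fourier f x + fourier g x := by
  simp only [fourier_eq_fourierInv_neg, fourierInv_eq, ← smul_add, Pi.add_apply]
  simp only [smul_add]
  rw [integral_add (integrable_cexp_smul hf _) (integrable_cexp_smul hg _), smul_add]

theorem fourierInv_congr_ae {f g : Plane → V} (h : f =ᵐ[volume] g) :
    fourierInv f = fourierInv g := by
  funext x
  simp only [fourierInv_eq]
  congr 1
  refine integral_congr_ae ?_
  filter_upwards [h] with ξ hξ
  rw [hξ]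

end PaperFourier

/-! ### Real interpolation along the line of dual exponents. -/

section Marcinkiewicz

open Set

/-- The part of `u` above the height `γ` has `L¹` norm at most `γ^{1-p} ‖u‖_p^p`. -/
theorem setLIntegral_above_le {α : Type*} [MeasurableSpace α] {μ : Measure α} {u : α → ℝ}
    (hu : Measurable u) {p γ : ℝ} (hp : 1 < p) (hγ : 0 < γ) :
    ∫⁻ x in {x | γ < u x}, ENNReal.ofReal (u x) ∂μ ≤
      ENNReal.ofReal (γ ^ (1 - p)) * ∫⁻ x, ENNReal.ofReal (u x ^ p) ∂μ := by
  rw [← lintegral_const_mul' _ _ ENNReal.ofReal_ne_top]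
  refine le_trans (setLIntegral_mono' (measurableSet_lt measurable_const hu) fun x hx => ?_)
    (setLIntegral_le_lintegral _ _)
  have hx : γ < u x := hx
  have hx0 : 0 < u x := hγ.trans hx
  rw [← ENNReal.ofReal_mul (by positivity)]
  refine ENNReal.ofReal_le_ofReal ?_
  have h1 : u x = u x ^ (1 - p) * u x ^ p := by
    rw [← Real.rpow_add hx0]; simp
  calc u x = u x ^ (1 - p) * u x ^ p := h1
    _ ≤ γ ^ (1 - p) * u x ^ p := by
      gcongr ?_ * _
      exact Real.rpow_le_rpow_of_nonpos hγ hx.le (by linarith)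

theorem setLIntegral_rpow_Ioc {Λ r : ℝ} (hΛ : 0 ≤ Λ) (hr : -1 < r) :
    ∫⁻ t in Ioc 0 Λ, ENNReal.ofReal (t ^ r) = ENNReal.ofReal (Λ ^ (r + 1) / (r + 1)) := by
  rw [← ofReal_integral_eq_lintegral_ofReal]
  · rw [← intervalIntegral.integral_of_le hΛ, integral_rpow (Or.inl hr),
      Real.zero_rpow (by linarith), sub_zero]
  · exact (intervalIntegral.intervalIntegrable_rpow' hr).1
  · exact (ae_restrict_mem measurableSet_Ioc).mono fun t ht => Real.rpow_nonneg ht.1.le _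

/-- Off-diagonal Marcinkiewicz interpolation between `L¹ → L^∞` and `L² → L²`. -/
theorem lintegral_rpow_le_of_split {α β V : Type*} [MeasurableSpace α] [MeasurableSpace β]
    [NormedAddCommGroup V] {μ : Measure α} [SFinite μ] {ν : Measure β}
    {u : α → ℝ} (hu : Measurable u) (hu0 : ∀ x, 0 ≤ u x)
    {F : β → V} (hF : AEStronglyMeasurable F ν) {p q : ℝ} (hp : 1 < p) (hq : 2 < q)
    (hpq : (p - 1) * (q - 1) = 1) {A₁ A₂ N : ℝ} (hA₁ : 0 < A₁) (hN : 0 < N)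
    (hNu : ∫⁻ x, ENNReal.ofReal (u x ^ p) ∂μ ≤ ENNReal.ofReal N)
    (hsplit : ∀ γ : ℝ, 0 < γ → ∃ F₁ F₂ : β → V, AEStronglyMeasurable F₂ ν ∧
      (∀ x, F x = F₁ x + F₂ x) ∧
      (∀ x, ‖F₁ x‖ₑ ≤ ENNReal.ofReal A₁ * ∫⁻ x in {x | γ < u x}, ENNReal.ofReal (u x) ∂μ) ∧
      ∫⁻ x, ‖F₂ x‖ₑ ^ 2 ∂ν ≤ ENNReal.ofReal (A₂ ^ 2) *
        ∫⁻ x in {x | u x ≤ γ}, ENNReal.ofReal (u x ^ 2) ∂μ) :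
    ∫⁻ x, ENNReal.ofReal (‖F x‖ ^ q) ∂ν ≤
      ENNReal.ofReal (q * (4 * A₂ ^ 2 * ((2 * A₁ * N) ^ (q - 2) / (q - 2) * N))) := by
  have hp1 : 0 < p - 1 := by linarith
  set K : ℝ := 2 * A₁ * N with hK
  have hK0 : 0 < K := by positivity
  -- The cut height for level `t` is chosen so that the part above it contributes at most `A₁
  -- γ^{1-p} N = t/2` in sup norm. Where `t < ‖F‖`, the `L²` part then exceeds `t/2`, and Chebyshev
  -- applies.
  set γ : ℝ → ℝ := fun t => (t / K) ^ (-(p - 1)⁻¹) with hγ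
  have hγm : Measurable γ := by fun_prop
  have hγ0 : ∀ t, 0 < t → 0 < γ t := fun t ht => by positivity
  have hγp : ∀ t, 0 < t → γ t ^ (1 - p) = t / K := fun t ht => by
    rw [hγ]
    simp only
    rw [← Real.rpow_mul (by positivity)]
    have : -(p - 1)⁻¹ * (1 - p) = 1 := by field_simp; ring
    rw [this, Real.rpow_one]
  -- the distribution function of `F`
  have hdist : ∀ t ∈ Ioi (0 : ℝ), ν {x | t < ‖F x‖} ≤
      ENNReal.ofReal (4 * A₂ ^ 2 * (t ^ 2)⁻¹) *
        ∫⁻ x in {x | u x ≤ γ t}, ENNReal.ofReal (u x ^ 2) ∂μ := by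
    intro t ht
    have ht : 0 < t := ht
    obtain ⟨F₁, F₂, hF₂m, hadd, h1, h2⟩ := hsplit (γ t) (hγ0 t ht)
    have hb1 : ∀ x, ‖F₁ x‖ ≤ t / 2 := fun x => by
      have h3 := (h1 x).trans (mul_le_mul_right ((setLIntegral_above_le hu hp (hγ0 t ht)).trans
        (mul_le_mul_right hNu _)) _)
      rw [hγp t ht, ← ENNReal.ofReal_mul (by positivity), ← ENNReal.ofReal_mul (by positivity),
        ← ofReal_norm, ENNReal.ofReal_le_ofReal_iff (by positivity)] at h3
      refine h3.trans (le_of_eq ?_)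
      rw [hK]; field_simp
    have hsub : {x | t < ‖F x‖} ⊆ {x | ENNReal.ofReal ((t / 2) ^ 2) ≤ ‖F₂ x‖ₑ ^ 2} := by
      intro x hx
      have hx : t < ‖F x‖ := hx
      have h4 : t / 2 ≤ ‖F₂ x‖ := by
        have := norm_add_le (F₁ x) (F₂ x)
        rw [← hadd] at this
        linarith [hb1 x]
      rw [mem_ofPred_eq, ← ofReal_norm, ← ENNReal.ofReal_pow (norm_nonneg _)]
      exact ENNReal.ofReal_le_ofReal (pow_le_pow_left₀ (by positivity) h4 2)
    have hcheb := mul_meas_ge_le_lintegral₀ (hF₂m.enorm.pow_const 2)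
      (ENNReal.ofReal ((t / 2) ^ 2))
    have h5 := (mul_le_mul_right (measure_mono hsub) _).trans (hcheb.trans h2)
    have h6 : ENNReal.ofReal (4 * (t ^ 2)⁻¹) * ENNReal.ofReal ((t / 2) ^ 2) = 1 := by
      rw [← ENNReal.ofReal_mul (by positivity), ← ENNReal.ofReal_one]
      congr 1; field_simp; norm_num
    calc ν {x | t < ‖F x‖} = ENNReal.ofReal (4 * (t ^ 2)⁻¹) * (ENNReal.ofReal ((t / 2) ^ 2) *
          ν {x | t < ‖F x‖}) := by rw [← mul_assoc, h6, one_mul]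
      _ ≤ ENNReal.ofReal (4 * (t ^ 2)⁻¹) * (ENNReal.ofReal (A₂ ^ 2) *
        ∫⁻ x in {x | u x ≤ γ t}, ENNReal.ofReal (u x ^ 2) ∂μ) := mul_le_mul_right h5 _
      _ = _ := by
        rw [← mul_assoc, ← ENNReal.ofReal_mul (by positivity)]
        congr 2; ring
  have hsetle : ∀ t, MeasurableSet {x | u x ≤ γ t} := fun t =>
    measurableSet_le hu measurable_const
  -- the inner integral after exchanging the order of integration
  have hinner : ∀ x, ∫⁻ t in Ioi (0 : ℝ), ENNReal.ofReal (4 * A₂ ^ 2 * t ^ (q - 3)) *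
      ({x | u x ≤ γ t}.indicator (fun x => ENNReal.ofReal (u x ^ 2)) x) ≤
      ENNReal.ofReal (4 * A₂ ^ 2 * (K ^ (q - 2) / (q - 2))) * ENNReal.ofReal (u x ^ p) := by
    intro x
    rcases (hu0 x).eq_or_lt with h0 | h0
    · have : ∀ t, {x | u x ≤ γ t}.indicator (fun x => ENNReal.ofReal (u x ^ 2)) x = 0 := fun t => by
        have h1 : ENNReal.ofReal (u x ^ 2) = 0 := by simp [← h0]
        rw [indicator_apply, h1, ite_self]
      simp only [this, mul_zero, lintegral_zero, zero_le]
    -- As `γ` is decreasing, `u x ≤ γ t` turns into `t ≤ Λ`; then `q > 2` makes `t^{q-3}` integrable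
    -- at `0`.
    set Λ : ℝ := K * u x ^ (-(p - 1)) with hΛ
    have hΛ0 : 0 < Λ := by positivity
    calc ∫⁻ t in Ioi (0 : ℝ), ENNReal.ofReal (4 * A₂ ^ 2 * t ^ (q - 3)) *
          ({x | u x ≤ γ t}.indicator (fun x => ENNReal.ofReal (u x ^ 2)) x)
        ≤ ∫⁻ t in Ioi (0 : ℝ), (Ioc 0 Λ).indicator (fun t => ENNReal.ofReal (4 * A₂ ^ 2) *
          ENNReal.ofReal (u x ^ 2) * ENNReal.ofReal (t ^ (q - 3))) t := by
          refine setLIntegral_mono' measurableSet_Ioi fun t ht => ?_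
          have ht : 0 < t := ht
          by_cases hx : u x ≤ γ t
          · have htΛ : t ≤ Λ := by
              have h7 : γ t ^ (1 - p) ≤ u x ^ (1 - p) :=
                Real.rpow_le_rpow_of_nonpos h0 hx (by linarith)
              rw [hγp t ht, div_le_iff₀ hK0] at h7
              rw [hΛ, neg_sub, mul_comm]; exact h7
            rw [indicator_of_mem (show t ∈ Ioc 0 Λ from ⟨ht, htΛ⟩), indicator_of_mem (show x ∈ {x | u x ≤ γ t} from hx),
              ENNReal.ofReal_mul (by positivity)]
            exact le_of_eq (by ring)
          · rw [indicator_of_notMem (by exact hx)]; simp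
      _ ≤ ∫⁻ t, (Ioc 0 Λ).indicator (fun t => ENNReal.ofReal (4 * A₂ ^ 2) *
          ENNReal.ofReal (u x ^ 2) * ENNReal.ofReal (t ^ (q - 3))) t :=
        setLIntegral_le_lintegral _ _
      _ = ENNReal.ofReal (4 * A₂ ^ 2) * ENNReal.ofReal (u x ^ 2) *
          ENNReal.ofReal (Λ ^ (q - 2) / (q - 2)) := by
        rw [lintegral_indicator measurableSet_Ioc, lintegral_const_mul' _ _ (by finiteness),
          setLIntegral_rpow_Ioc hΛ0.le (by linarith)]
        ring_nf
      _ = _ := by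
        rw [← ENNReal.ofReal_mul (by positivity),
          ← ENNReal.ofReal_mul (by positivity), ← ENNReal.ofReal_mul
            (mul_nonneg (by positivity) (div_nonneg (by positivity) (by linarith)))]
        congr 1
        rw [hΛ, Real.mul_rpow hK0.le (by positivity), ← Real.rpow_mul h0.le]
        -- Duality of the exponents enters here: `(p-1)(q-1) = 1` gives `2 - (p-1)(q-2) = p`.
        have h8 : u x ^ p = u x ^ 2 * u x ^ (-(p - 1) * (q - 2)) := by
          rw [← Real.rpow_natCast (u x) 2, ← Real.rpow_add h0]
          congr 1; push_cast; linear_combination hpq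
        rw [h8]; ring
  have hjoint : Measurable (Function.uncurry fun (t : ℝ) (x : α) =>
      ENNReal.ofReal (4 * A₂ ^ 2 * t ^ (q - 3)) *
        ({x | u x ≤ γ t}.indicator (fun x => ENNReal.ofReal (u x ^ 2)) x)) := by
    have hset : MeasurableSet {z : ℝ × α | u z.2 ≤ γ z.1} :=
      measurableSet_le (hu.comp measurable_snd) (hγm.comp measurable_fst)
    have h9 : Measurable ({z : ℝ × α | u z.2 ≤ γ z.1}.indicator
        fun z => ENNReal.ofReal (u z.2 ^ 2)) :=
      (((hu.comp measurable_snd).pow_const 2).ennreal_ofReal).indicator hset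
    exact (Measurable.ennreal_ofReal (by fun_prop)).mul h9
  rw [lintegral_rpow_eq_lintegral_meas_lt_mul ν (.of_forall fun x => norm_nonneg _)
    hF.norm.aemeasurable (by linarith), ENNReal.ofReal_mul (by linarith)]
  refine mul_le_mul_right ?_ _
  calc ∫⁻ t in Ioi (0 : ℝ), ν {x | t < ‖F x‖} * ENNReal.ofReal (t ^ (q - 1))
      ≤ ∫⁻ t in Ioi (0 : ℝ), ∫⁻ x, ENNReal.ofReal (4 * A₂ ^ 2 * t ^ (q - 3)) *
          ({x | u x ≤ γ t}.indicator (fun x => ENNReal.ofReal (u x ^ 2)) x) ∂μ := by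
        refine setLIntegral_mono' measurableSet_Ioi fun t ht => ?_
        have ht0 : 0 < t := ht
        rw [lintegral_const_mul' _ _ (by finiteness), lintegral_indicator (hsetle t)]
        refine (mul_le_mul_left (hdist t ht) _).trans (le_of_eq ?_)
        rw [mul_right_comm, ← ENNReal.ofReal_mul (by positivity)]
        congr 2
        have : t ^ (q - 1) = t ^ (q - 3) * t ^ 2 := by
          rw [← Real.rpow_natCast t 2, ← Real.rpow_add ht0]; congr 1; push_cast; ring
        rw [this]; field_simp
    _ = ∫⁻ x, (∫⁻ t in Ioi (0 : ℝ), ENNReal.ofReal (4 * A₂ ^ 2 * t ^ (q - 3)) *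
          ({x | u x ≤ γ t}.indicator (fun x => ENNReal.ofReal (u x ^ 2)) x)) ∂μ :=
      lintegral_lintegral_swap hjoint.aemeasurable
    _ ≤ ∫⁻ x, ENNReal.ofReal (4 * A₂ ^ 2 * (K ^ (q - 2) / (q - 2))) *
          ENNReal.ofReal (u x ^ p) ∂μ := lintegral_mono hinner
    _ ≤ ENNReal.ofReal (4 * A₂ ^ 2 * (K ^ (q - 2) / (q - 2))) * ENNReal.ofReal N := by
      rw [lintegral_const_mul' _ _ (by finiteness)]
      exact mul_le_mul_right hNu _
    _ = _ := by
      rw [← ENNReal.ofReal_mul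
        (mul_nonneg (by positivity) (div_nonneg (by positivity) (by linarith)))]
      congr 1; ring

end Marcinkiewicz

/-! ### `L^p → L^q` bounds for Fourier multipliers. -/

section Multiplier

variable {V : Type*} [NormedAddCommGroup V] [InnerProductSpace ℂ V]

/-- The Fourier multiplier `m(D) f` with symbol `m` acting on scalar functions. -/
noncomputable def multiplier (m : Plane → V) (f : Plane → ℂ) : Plane → V :=
  fourierInv fun ξ => fourier f ξ • m ξ

theorem integrable_fourier_smul {m : Plane → V} (hm : Integrable m) {f : Plane → ℂ}
    (hf : Integrable f) : Integrable fun ξ => fourier f ξ • m ξ :=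
  hm.bdd_smul (C := ∫ x, ‖f x‖) (continuous_fourier hf).aestronglyMeasurable
    (.of_forall (norm_fourier_le f))

theorem multiplier_add {m : Plane → V} (hm : Integrable m) {f g : Plane → ℂ}
    (hf : Integrable f) (hg : Integrable g) (x : Plane) :
    multiplier m (f + g) x = multiplier m f x + multiplier m g x := by
  simp only [multiplier, fourierInv_eq, fourier_add hf hg, add_smul]
  rw [← smul_add, ← integral_add (integrable_cexp_smul (integrable_fourier_smul hm hf) x)
    (integrable_cexp_smul (integrable_fourier_smul hm hg) x)]
  simp only [smul_add]

theorem enorm_multiplier_le (m : Plane → V) {f : Plane → ℂ} (hf : Integrable f) (x : Plane) :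
    ‖multiplier m f x‖ₑ ≤ (∫⁻ ξ, ‖m ξ‖ₑ) * ∫⁻ y, ‖f y‖ₑ := by
  refine (enorm_fourierInv_le _ x).trans ?_
  rw [mul_comm, ← lintegral_const_mul' _ _ hf.2.ne]
  refine lintegral_mono fun ξ => ?_
  rw [enorm_smul]
  exact mul_le_mul_left (enorm_fourier_le f ξ) _

theorem continuous_multiplier {m : Plane → V} (hm : Integrable m) {f : Plane → ℂ}
    (h1 : Integrable f) : Continuous (multiplier m f) :=
  continuous_fourierInv (integrable_fourier_smul hm h1)

theorem multiplier_eq_zero (m : Plane → V) {f : Plane → ℂ} (hf : f =ᵐ[volume] 0) :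
    multiplier m f = 0 := by
  funext x
  have : ∫⁻ y, ‖f y‖ₑ = 0 := by
    rw [lintegral_congr_ae (g := fun _ => 0) (by filter_upwards [hf] with y hy; simp [hy])]
    simp
  have h := enorm_fourier_le f
  simp only [this, nonpos_iff_eq_zero, enorm_eq_zero] at h
  simp [multiplier, fourierInv_eq, h]

theorem eLpNorm_eq_ofReal_lintegral {α W : Type*} [MeasurableSpace α] {μ : Measure α}
    [NormedAddCommGroup W] (f : α → W) {p : ℝ≥0∞} (hp0 : p ≠ 0) (hp : p ≠ ⊤) :
    eLpNorm f p μ = (∫⁻ x, ENNReal.ofReal (‖f x‖ ^ p.toReal) ∂μ) ^ (1 / p.toReal) := by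
  rw [eLpNorm_eq_lintegral_rpow_enorm_toReal hp0 hp]
  congr 2; funext x
  rw [← ofReal_norm, ENNReal.ofReal_rpow_of_nonneg (norm_nonneg _) ENNReal.toReal_nonneg]

theorem eLpNorm_two_sq {α W : Type*} [MeasurableSpace α] {μ : Measure α}
    [NormedAddCommGroup W] (f : α → W) : eLpNorm f 2 μ ^ 2 = ∫⁻ x, ‖f x‖ₑ ^ 2 ∂μ := by
  rw [eLpNorm_eq_lintegral_rpow_enorm_toReal (by norm_num) (by norm_num),
    ← ENNReal.rpow_natCast, ← ENNReal.rpow_mul]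
  norm_num

variable [CompleteSpace V]

theorem eLpNorm_two_multiplier_le {m : Plane → V} (hm : Integrable m) {A : ℝ}
    (hA : ∀ ξ, ‖m ξ‖ ≤ A) {f : Plane → ℂ} (h1 : Integrable f) (h2 : MemLp f 2) :
    eLpNorm (multiplier m f) 2 volume ≤ ENNReal.ofReal A * eLpNorm f 2 volume := by
  have hb : eLpNorm (fun ξ => fourier f ξ • m ξ) 2 volume ≤
      ENNReal.ofReal A * eLpNorm f 2 volume := by
    rw [← eLpNorm_two_fourier h1 h2]
    refine eLpNorm_le_mul_eLpNorm_of_ae_le_mul (.of_forall fun ξ => ?_) _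
    rw [norm_smul, mul_comm]
    exact mul_le_mul_of_nonneg_right (hA ξ) (norm_nonneg _)
  have hi := integrable_fourier_smul hm h1
  rw [multiplier, eLpNorm_two_fourierInv hi ⟨hi.1, hb.trans_lt (by finiteness [h2.2])⟩]
  exact hb

/-- The `L^p → L^q` bound for `1 < p < 2`, by interpolation. -/
theorem eLpNorm_multiplier_le_of_lt {p q : ℝ} (hp : 1 < p) (hq : 2 < q)
    (hpq : (p - 1) * (q - 1) = 1) {m : Plane → V} (hm : Integrable m) {A₁ A₂ : ℝ}
    (hA₁ : 0 < A₁) (hA₂ : 0 < A₂) (hm₁ : ∫⁻ ξ, ‖m ξ‖ₑ ≤ ENNReal.ofReal A₁)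
    (hm₂ : ∀ ξ, ‖m ξ‖ ≤ A₂) {f : Plane → ℂ} (hf : Measurable f) (h1 : Integrable f)
    (h2 : MemLp f 2) (hfp : MemLp f (ENNReal.ofReal p)) :
    eLpNorm (multiplier m f) (ENNReal.ofReal q) volume ≤
      ENNReal.ofReal ((q * 4 * 2 ^ (q - 2) / (q - 2)) ^ (1 / q) *
        (A₁ ^ (1 - 2 / q) * A₂ ^ (2 / q))) * eLpNorm f (ENNReal.ofReal p) volume := by
  have hp0 : ENNReal.ofReal p ≠ 0 := by simp; linarith
  have hq0 : ENNReal.ofReal q ≠ 0 := by simp; linarith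
  have hpt : (ENNReal.ofReal p).toReal = p := ENNReal.toReal_ofReal (by linarith)
  have hqt : (ENNReal.ofReal q).toReal = q := ENNReal.toReal_ofReal (by linarith)
  -- The interpolation divides by `N = ‖f‖_p^p`, so vanishing data are treated apart.
  rcases eq_or_ne (eLpNorm f (ENNReal.ofReal p) volume) 0 with h0 | h0
  · rw [multiplier_eq_zero m ((eLpNorm_eq_zero_iff hf.aestronglyMeasurable hp0).1 h0)]
    simp
  have hfin := hfp.2.ne
  rw [eLpNorm_eq_ofReal_lintegral _ hp0 ENNReal.ofReal_ne_top, hpt] at h0 hfin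
  rw [eLpNorm_eq_ofReal_lintegral _ hp0 ENNReal.ofReal_ne_top, hpt,
    eLpNorm_eq_ofReal_lintegral _ hq0 ENNReal.ofReal_ne_top, hqt]
  have hpi : 0 < 1 / p := by positivity
  have hI0 : ∫⁻ x, ENNReal.ofReal (‖f x‖ ^ p) ≠ 0 := fun h => h0 (by
    rw [h, ENNReal.zero_rpow_of_pos hpi])
  have hIt : ∫⁻ x, ENNReal.ofReal (‖f x‖ ^ p) ≠ ⊤ := fun h => hfin (by
    rw [h, ENNReal.top_rpow_of_pos hpi])
  obtain ⟨N, hN, hNe⟩ : ∃ N : ℝ, 0 < N ∧ ∫⁻ x, ENNReal.ofReal (‖f x‖ ^ p) = ENNReal.ofReal N :=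
    ⟨_, ENNReal.toReal_pos hI0 hIt, (ENNReal.ofReal_toReal hIt).symm⟩
  have key := lintegral_rpow_le_of_split (F := multiplier m f) (ν := volume) (μ := volume)
    (u := fun x => ‖f x‖) hf.norm (fun x => norm_nonneg _)
    (continuous_multiplier hm h1).aestronglyMeasurable hp hq hpq (A₂ := A₂) hA₁ hN hNe.le
    (fun γ hγ => by
      have hs1 : MeasurableSet {x | γ < ‖f x‖} := measurableSet_lt measurable_const hf.norm
      have hs2 : MeasurableSet {x | ‖f x‖ ≤ γ} := measurableSet_le hf.norm measurable_const
      refine ⟨multiplier m ({x | γ < ‖f x‖}.indicator f), multiplier m ({x | ‖f x‖ ≤ γ}.indicator f),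
        (continuous_multiplier hm (h1.indicator hs2)).aestronglyMeasurable, fun x => ?_, fun x => ?_,
        ?_⟩
      · rw [← multiplier_add hm (h1.indicator hs1) (h1.indicator hs2)]
        congr 1
        have : {x | ‖f x‖ ≤ γ} = {x | γ < ‖f x‖}ᶜ := by ext x; simp
        rw [this, Set.indicator_self_add_compl]
      · refine (enorm_multiplier_le _ (h1.indicator hs1) x).trans ?_
        simp only [enorm_indicator_eq_indicator_enorm, lintegral_indicator hs1, ofReal_norm]
        exact mul_le_mul_left hm₁ _
      · have h := eLpNorm_two_multiplier_le hm hm₂ (h1.indicator hs2) (h2.indicator hs2)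
        have h' := pow_le_pow_left' h 2
        rw [eLpNorm_two_sq, mul_pow, eLpNorm_two_sq, ← ENNReal.ofReal_pow hA₂.le] at h'
        refine h'.trans (le_of_eq ?_)
        congr 1
        rw [← lintegral_indicator hs2]
        congr 1; funext x
        by_cases hx : x ∈ {x | ‖f x‖ ≤ γ}
        · rw [Set.indicator_of_mem hx, Set.indicator_of_mem hx, ← ofReal_norm,
            ENNReal.ofReal_pow (norm_nonneg _)]
        · rw [Set.indicator_of_notMem hx, Set.indicator_of_notMem hx]; simp)
  refine (ENNReal.rpow_le_rpow key (by positivity)).trans (le_of_eq ?_)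
  have hq2 : 0 < q - 2 := by linarith
  rw [hNe, ENNReal.ofReal_rpow_of_pos (by positivity), ENNReal.ofReal_rpow_of_pos (by positivity),
    ← ENNReal.ofReal_mul (by positivity)]
  congr 1
  have e1 : q * (4 * A₂ ^ 2 * ((2 * A₁ * N) ^ (q - 2) / (q - 2) * N)) =
      (q * 4 * 2 ^ (q - 2) / (q - 2)) * (A₁ ^ (q - 2) * A₂ ^ (2 : ℝ)) * N ^ (q - 1) := by
    rw [Real.mul_rpow (by positivity) hN.le, Real.mul_rpow (by norm_num) hA₁.le]
    have : N ^ (q - 1) = N ^ (q - 2) * N := by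
      rw [← Real.rpow_add_one hN.ne']; congr 1; ring
    rw [this, Real.rpow_two]; ring
  rw [e1, Real.mul_rpow (by positivity) (by positivity), Real.mul_rpow (by positivity)
    (by positivity), Real.mul_rpow (by positivity) (by positivity), ← Real.rpow_mul hA₁.le,
    ← Real.rpow_mul hA₂.le, ← Real.rpow_mul hN.le]
  have hq' : q ≠ 0 := by linarith
  have hp' : p ≠ 0 := by linarith
  have x1 : (q - 2) * (1 / q) = 1 - 2 / q := by field_simp
  have x2 : 2 * (1 / q) = 2 / q := by ring
  have x3 : (q - 1) * (1 / q) = 1 / p := by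
    rw [mul_one_div, div_eq_div_iff hq' hp']; linear_combination hpq
  rw [x1, x2, x3]

/-- The `L^p → L^q` bound for a bounded and integrable symbol, `1 ≤ p ≤ 2`, `1/p + 1/q = 1`. -/
theorem exists_eLpNorm_multiplier_le {p q : ℝ≥0∞} (hp1 : 1 ≤ p) (hp2 : p ≤ 2)
    (hpq : 1 / p + 1 / q = 1) : ∃ C : ℝ, 0 < C ∧
      ∀ (m : Plane → V) (A₁ A₂ : ℝ), Integrable m → 0 < A₁ → 0 < A₂ →
        ∫⁻ ξ, ‖m ξ‖ₑ ≤ ENNReal.ofReal A₁ → (∀ ξ, ‖m ξ‖ ≤ A₂) → ∀ f : 𝓢(Plane, ℂ),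
        eLpNorm (multiplier m f) q volume ≤
          ENNReal.ofReal (C * (A₁ ^ ((1 / p).toReal - (1 / q).toReal) *
            A₂ ^ (1 - ((1 / p).toReal - (1 / q).toReal)))) * eLpNorm f p volume := by
  simp only [one_div] at hpq ⊢
  -- The endpoints are proved directly: `p = 1` has `q = ∞`, and at `p = 2` the interpolation
  -- constant, with its factor `1/(q-2)`, breaks down.
  rcases hp1.eq_or_lt with rfl | hp1
  · have hq : q = ⊤ := by
      have : (1 : ℝ≥0∞) + q⁻¹ = 1 + 0 := by simpa using hpq
      simpa using (ENNReal.add_right_inj ENNReal.one_ne_top).1 this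
    subst hq
    refine ⟨1, one_pos, fun m A₁ A₂ hm hA₁ hA₂ hm₁ hm₂ f => ?_⟩
    simp only [inv_one, ENNReal.toReal_one, ENNReal.inv_top, ENNReal.toReal_zero, sub_zero,
      Real.rpow_one, sub_self, Real.rpow_zero, mul_one, one_mul, eLpNorm_exponent_top,
      eLpNorm_one_eq_lintegral_enorm]
    exact eLpNormEssSup_le_of_ae_enorm_bound (.of_forall fun x =>
      (enorm_multiplier_le m f.integrable x).trans (mul_le_mul_left hm₁ _))
  rcases hp2.eq_or_lt with rfl | hp2
  · have hq : q = 2 := by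
      have : (2 : ℝ≥0∞)⁻¹ + q⁻¹ = 2⁻¹ + 2⁻¹ := by rw [hpq, ENNReal.inv_two_add_inv_two]
      exact inv_injective ((ENNReal.add_right_inj (by simp)).1 this)
    subst hq
    refine ⟨1, one_pos, fun m A₁ A₂ hm hA₁ hA₂ hm₁ hm₂ f => ?_⟩
    simpa using eLpNorm_two_multiplier_le hm hm₂ f.integrable (f.memLp 2)
  have hpt : p ≠ ⊤ := (hp2.trans (by norm_num)).ne
  obtain ⟨p, rfl⟩ : ∃ r : ℝ, p = ENNReal.ofReal r := ⟨_, (ENNReal.ofReal_toReal hpt).symm⟩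
  have hp1' : 1 < p := by simpa using hp1
  have hp2' : p < 2 := by
    rw [← ENNReal.ofReal_ofNat, ENNReal.ofReal_lt_ofReal_iff (by norm_num)] at hp2
    exact hp2
  have hp0 : 0 < p := by linarith
  have hpi : p⁻¹ < 1 := inv_lt_one_of_one_lt₀ hp1'
  have hpi' : 2⁻¹ < p⁻¹ := by gcongr
  have hqi : q⁻¹ = ENNReal.ofReal (1 - p⁻¹) := by
    rw [← ENNReal.ofReal_inv_of_pos hp0] at hpq
    rw [ENNReal.ofReal_sub _ (by positivity), ENNReal.ofReal_one]
    exact ENNReal.eq_sub_of_add_eq' (by simp) (by rw [add_comm]; exact hpq)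
  set r : ℝ := (1 - p⁻¹)⁻¹ with hr
  have hr2 : 2 < r := by
    rw [hr, lt_inv_comm₀ (by norm_num) (by linarith)]; linarith
  have hq : q = ENNReal.ofReal r := by
    rw [hr, ENNReal.ofReal_inv_of_pos (by linarith), ← hqi, inv_inv]
  subst hq
  have hri : r⁻¹ = 1 - p⁻¹ := by rw [hr, inv_inv]
  have hd : (ENNReal.ofReal p)⁻¹.toReal - (ENNReal.ofReal r)⁻¹.toReal = 1 - 2 / r := by
    rw [← ENNReal.ofReal_inv_of_pos hp0, ← ENNReal.ofReal_inv_of_pos (by linarith),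
      ENNReal.toReal_ofReal (by positivity), ENNReal.toReal_ofReal (by rw [hri]; linarith),
      div_eq_mul_inv, hri]
    ring
  have hr2' : 0 < r - 2 := by linarith
  refine ⟨(r * 4 * 2 ^ (r - 2) / (r - 2)) ^ (1 / r), by positivity,
    fun m A₁ A₂ hm hA₁ hA₂ hm₁ hm₂ f => ?_⟩
  rw [hd, sub_sub_cancel]
  refine eLpNorm_multiplier_le_of_lt hp1' hr2 ?_ hm hA₁ hA₂ hm₁ hm₂ f.continuous.measurable
    f.integrable (f.memLp 2) (f.memLp _)
  have h2 : p * r = p + r := by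
    have h3 : r ≠ 0 := by linarith
    have h4 := hri
    field_simp at h4
    linarith
  linarith

end Multiplier

/-! ### The coupled pair of half-waves at one frequency. -/

section Pair

/-- `(w, z)` solves the system that couples the two half-waves of speed `c` at frequency `ξ`,
where `ρ = c |ξ|`. -/
def IsHalfWavePair (ρ : ℝ) (w z : ℝ → ℂ) : Prop :=
  ∀ t, HasDerivAt w ((I * ρ - ρ ^ 2 / 2) * w t - ρ ^ 2 / 2 * z t) t ∧
    HasDerivAt z ((-(I * ρ) - ρ ^ 2 / 2) * z t - ρ ^ 2 / 2 * w t) t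

/-- Exchanging the two waves reverses the sign of `ρ`, so each bound for `w` also serves for `z`. -/
theorem IsHalfWavePair.swap {ρ : ℝ} {w z : ℝ → ℂ} (h : IsHalfWavePair ρ w z) :
    IsHalfWavePair (-ρ) z w := fun t =>
  ⟨by convert (h t).2 using 1; push_cast; ring, by convert (h t).1 using 1; push_cast; ring⟩

/-- The Lyapunov functional of a pair of half-waves. -/
theorem IsHalfWavePair.lyapunov {ρ δ : ℝ} (hδ : 0 < δ) (hδρ : δ * (1 + ρ ^ 2) ≤ 1) {w z : ℝ → ℂ}
    (h : IsHalfWavePair ρ w z) {t : ℝ} (ht : 0 ≤ t) :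
    normSq (w t) + normSq (z t) + δ * ρ * ((w t).im * (z t).re - (w t).re * (z t).im) ≤
      Real.exp (-(δ / 3 * ρ ^ 2 * t)) *
      (normSq (w 0) + normSq (z 0) + δ * ρ * ((w 0).im * (z 0).re - (w 0).re * (z 0).im)) := by
  -- The derivative of `|w|² + |z|²` is `-ρ²|w + z|²`, which gives no damping when `z = -w`. The
  -- cross term `δρ Im(w z̄)` supplies the missing `-(δ/2)ρ²|w - z|²`.
  set E : ℝ → ℝ := fun t =>
    normSq (w t) + normSq (z t) + δ * ρ * ((w t).im * (z t).re - (w t).re * (z t).im) with hE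
  have hre : ∀ {f : ℝ → ℂ} {f' : ℂ} {t : ℝ}, HasDerivAt f f' t →
      HasDerivAt (fun t => (f t).re) f'.re t := fun hf =>
    reCLM.hasFDerivAt.comp_hasDerivAt _ hf
  have him : ∀ {f : ℝ → ℂ} {f' : ℂ} {t : ℝ}, HasDerivAt f f' t →
      HasDerivAt (fun t => (f t).im) f'.im t := fun hf =>
    imCLM.hasFDerivAt.comp_hasDerivAt _ hf
  have hder : ∀ t, ∃ E' : ℝ, HasDerivAt E E' t ∧ E' ≤ -(δ / 3 * ρ ^ 2) * E t := by
    intro t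
    have h1 := hre (h t).1
    have h2 := him (h t).1
    have h3 := hre (h t).2
    have h4 := him (h t).2
    have hd := (((h1.mul h1).add (h2.mul h2)).add ((h3.mul h3).add (h4.mul h4))).add
      (((h2.mul h3).sub (h1.mul h4)).const_mul (δ * ρ))
    refine ⟨_, hd, ?_⟩
    have e2 : ((ρ : ℂ) ^ 2 / 2) = ((ρ ^ 2 / 2 : ℝ) : ℂ) := by push_cast; ring
    simp only [hE, e2, normSq_apply, sub_re, sub_im, mul_re, mul_im, I_re, I_im, ofReal_re,
      ofReal_im, neg_re, neg_im]
    -- In the coordinates `w = x + iy`, `z = x - iy` the dissipation inequality splits into the same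
    -- real quadratic form in `(x₁, y₁)` and in `(x₂, y₂)`; `hq` shows it nonnegative by completing
    -- the square in `y`.
    obtain ⟨x₁, hx₁⟩ : ∃ x₁, x₁ = ((w t).re + (z t).re) / 2 := ⟨_, rfl⟩
    obtain ⟨x₂, hx₂⟩ : ∃ x₂, x₂ = ((w t).im + (z t).im) / 2 := ⟨_, rfl⟩
    obtain ⟨y₁, hy₁⟩ : ∃ y₁, y₁ = ((w t).im - (z t).im) / 2 := ⟨_, rfl⟩
    obtain ⟨y₂, hy₂⟩ : ∃ y₂, y₂ = ((z t).re - (w t).re) / 2 := ⟨_, rfl⟩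
    have a1 : (w t).re = x₁ - y₂ := by linarith
    have a2 : (w t).im = x₂ + y₁ := by linarith
    have a3 : (z t).re = x₁ + y₂ := by linarith
    have a4 : (z t).im = x₂ - y₁ := by linarith
    rw [a1, a2, a3, a4]
    have hδ1 : δ ≤ 1 := by nlinarith [sq_nonneg ρ]
    have hq : ∀ x y : ℝ, 0 ≤ (2 - 4 * δ / 3) * x ^ 2 + 2 * δ / 3 * y ^ 2 +
        δ * ρ * (1 - δ / 3) * (x * y) := by
      intro x y
      have k1 : δ * ρ ^ 2 ≤ 1 := by nlinarith
      have k2 : (1 - δ / 3) ^ 2 ≤ 1 := by nlinarith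
      have k3 : δ * ρ ^ 2 * (1 - δ / 3) ^ 2 ≤ 1 := by
        nlinarith [mul_nonneg hδ.le (sq_nonneg ρ), sq_nonneg (1 - δ / 3)]
      have k4 : 0 ≤ δ / 2 * (y + ρ * (1 - δ / 3) * x) ^ 2 := by positivity
      have k5 : δ * ρ ^ 2 * (1 - δ / 3) ^ 2 * x ^ 2 ≤ 1 * x ^ 2 :=
        mul_le_mul_of_nonneg_right k3 (sq_nonneg x)
      nlinarith [sq_nonneg x, mul_nonneg hδ.le (sq_nonneg y),
        mul_nonneg (sub_nonneg.2 hδ1) (sq_nonneg x)]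
    have q1 := mul_nonneg (sq_nonneg ρ) (hq x₁ y₁)
    have q2 := mul_nonneg (sq_nonneg ρ) (hq x₂ y₂)
    nlinarith [q1, q2]
  choose E' hE' hle using hder
  have hg : ∀ t, HasDerivAt (fun t => Real.exp (δ / 3 * ρ ^ 2 * t) * E t)
      (Real.exp (δ / 3 * ρ ^ 2 * t) * (δ / 3 * ρ ^ 2 * 1) * E t +
        Real.exp (δ / 3 * ρ ^ 2 * t) * E' t) t := fun t =>
    ((((hasDerivAt_id t).const_mul _).exp).mul (hE' t))
  have hanti : Antitone (fun t => Real.exp (δ / 3 * ρ ^ 2 * t) * E t) :=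
    antitone_of_hasDerivAt_nonpos hg fun t => by
      have := mul_le_mul_of_nonneg_left (hle t) (Real.exp_pos (δ / 3 * ρ ^ 2 * t)).le
      rw [Pi.zero_apply]
      linarith
  have h0 := hanti ht
  simp only [mul_zero, Real.exp_zero, one_mul] at h0
  rw [Real.exp_neg, ← div_eq_inv_mul, le_div_iff₀ (Real.exp_pos _), mul_comm]
  exact h0

/-- Since `|δρ| ≤ 1/2`, the cross term is at most half of `|w|² + |z|²`. Comparing the functional
with that sum costs a factor `3`, and the square root halves the rate and leaves `√3 ≤ 2`. -/
theorem IsHalfWavePair.norm_le {ρ δ : ℝ} (hδ : 0 < δ) (hδρ : δ * (1 + ρ ^ 2) ≤ 1) {w z : ℝ → ℂ}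
    (h : IsHalfWavePair ρ w z) {t : ℝ} (ht : 0 ≤ t) :
    ‖w t‖ ≤ 2 * Real.exp (-(δ / 6 * ρ ^ 2 * t)) * (‖w 0‖ + ‖z 0‖) := by
  have h1 := h.lyapunov hδ hδρ ht
  have hb : ∀ w z : ℂ, |δ * ρ * (w.im * z.re - w.re * z.im)| ≤ (normSq w + normSq z) / 2 := by
    intro w z
    have k1 : |δ * ρ| ≤ 1 / 2 := by
      rw [abs_mul, abs_of_pos hδ]
      nlinarith [sq_nonneg (|ρ| - 1), sq_abs ρ]
    have k2 : |w.im * z.re - w.re * z.im| ≤ normSq w + normSq z := by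
      rw [normSq_apply, normSq_apply, abs_le]
      constructor <;> nlinarith [sq_nonneg (w.im + z.re), sq_nonneg (w.im - z.re),
        sq_nonneg (w.re + z.im), sq_nonneg (w.re - z.im)]
    rw [abs_mul]
    nlinarith [abs_nonneg (δ * ρ), abs_nonneg (w.im * z.re - w.re * z.im)]
  have h2 := (abs_le.1 (hb (w t) (z t))).1
  have h3 := (abs_le.1 (hb (w 0) (z 0))).2
  have e1 : Real.exp (-(δ / 3 * ρ ^ 2 * t)) = Real.exp (-(δ / 6 * ρ ^ 2 * t)) ^ 2 := by
    rw [← Real.exp_nat_mul]; congr 1; push_cast; ring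
  rw [e1] at h1
  set e := Real.exp (-(δ / 6 * ρ ^ 2 * t))
  have he : 0 < e := Real.exp_pos _
  refine abs_le_of_sq_le_sq' ?_ (by positivity) |>.2
  simp only [normSq_eq_norm_sq] at h1 h2 h3
  have h4 := mul_le_mul_of_nonneg_left h3 (sq_nonneg e)
  have h5 : 0 ≤ e ^ 2 * (‖w 0‖ * ‖z 0‖) := by positivity
  have h6 : 0 ≤ e ^ 2 * (‖w 0‖ ^ 2) := by positivity
  have h7 : 0 ≤ e ^ 2 * (‖z 0‖ ^ 2) := by positivity
  nlinarith [sq_nonneg (‖z t‖)]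

/-- A normal form: `α = iρ/4` is the solution of `-2iρα = ρ²/2`, for which the `z` terms in the
equation of `w + αz` combine to `μαz`. What remains is the forcing `-α(ρ²/2)w` of cubic order, and
undoing the change of variable costs `O(|ρ|)`. -/
theorem IsHalfWavePair.norm_sub_le {ρ δ : ℝ} (hδ : 0 < δ) (hδρ : δ * (1 + ρ ^ 2) ≤ 1)
    {w z : ℝ → ℂ} (h : IsHalfWavePair ρ w z) {t : ℝ} (ht : 0 ≤ t) :
    ‖w t - cexp ((I * ρ - ρ ^ 2 / 2) * t) * w 0‖ ≤
      (3 / δ + 1) * |ρ| * Real.exp (-(δ / 12 * ρ ^ 2 * t)) * (‖w 0‖ + ‖z 0‖) := by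
  set D := ‖w 0‖ + ‖z 0‖ with hD
  have hD0 : 0 ≤ D := by positivity
  have hδ1 : δ ≤ 1 := by nlinarith [sq_nonneg ρ]
  set μ : ℂ := I * ρ - ρ ^ 2 / 2 with hμ
  set α : ℂ := I * ρ / 4 with hα
  have hμre : μ.re = -(ρ ^ 2 / 2) := by
    have e2 : ((ρ : ℂ) ^ 2 / 2) = ((ρ ^ 2 / 2 : ℝ) : ℂ) := by push_cast; ring
    rw [hμ, e2, sub_re, ofReal_re]; simp
  have hαn : ‖α‖ = |ρ| / 4 := by simp [hα]
  have hexp : ∀ s : ℝ, ‖cexp (μ * s)‖ = Real.exp (-(ρ ^ 2 / 2 * s)) := fun s => by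
    rw [norm_exp, mul_re, hμre]; simp
  have hder : ∀ s : ℝ, HasDerivAt (fun s : ℝ => cexp (-(μ * s)) * (w s + α * z s))
      (-(cexp (-(μ * s)) * (α * (ρ ^ 2 / 2) * w s))) s := fun s => by
    have h1 : HasDerivAt (fun s : ℝ => cexp (-(μ * s))) (cexp (-(μ * s)) * (-(μ * 1))) s :=
      (((ofRealCLM.hasDerivAt (x := s)).const_mul μ).neg).cexp
    refine (h1.mul ((h s).1.add ((h s).2.const_mul α))).congr_deriv ?_
    simp only [Pi.add_apply]
    have : α * (-(I * ρ) - ρ ^ 2 / 2) - ρ ^ 2 / 2 = μ * α := by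
      rw [hμ, hα]; ring_nf; simp only [I_sq]; ring
    linear_combination cexp (-(μ * s)) * z s * this
  have hbound : ∀ s ∈ Set.Ico 0 t, ‖-(cexp (-(μ * s)) * (α * (ρ ^ 2 / 2) * w s))‖ ≤
      Real.exp ((1 / 2 - δ / 6) * ρ ^ 2 * t) * (|ρ| ^ 3 / 4 * D) := fun s hs => by
    have h1 := h.norm_le hδ hδρ hs.1
    have e3 : ‖(ρ : ℂ) ^ 2 / 2‖ = |ρ| ^ 2 / 2 := by simp
    rw [norm_neg, norm_mul, norm_mul, norm_mul, hαn, e3, Complex.exp_neg, norm_inv, hexp,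
      ← Real.exp_neg, neg_neg]
    calc Real.exp (ρ ^ 2 / 2 * s) * (|ρ| / 4 * (|ρ| ^ 2 / 2) * ‖w s‖)
        ≤ Real.exp (ρ ^ 2 / 2 * s) * (|ρ| / 4 * (|ρ| ^ 2 / 2) *
          (2 * Real.exp (-(δ / 6 * ρ ^ 2 * s)) * D)) := by gcongr
      _ = Real.exp ((1 / 2 - δ / 6) * ρ ^ 2 * s) * (|ρ| ^ 3 / 4 * D) := by
        have : (1 / 2 - δ / 6) * ρ ^ 2 * s = ρ ^ 2 / 2 * s + -(δ / 6 * ρ ^ 2 * s) := by ring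
        rw [this, Real.exp_add]; ring
      _ ≤ _ := by
        -- The exponent grows with `s`, so its value at `s = t` bounds the derivative on the whole
        -- interval.
        have : 0 ≤ 1 / 2 - δ / 6 := by linarith
        gcongr
        exact hs.2.le
  have hmv := norm_image_sub_le_of_norm_deriv_le_segment' (f := fun s : ℝ =>
    cexp (-(μ * s)) * (w s + α * z s)) (fun s _ => (hder s).hasDerivWithinAt) hbound t
    (Set.right_mem_Icc.2 ht)
  simp only [ofReal_zero, mul_zero, neg_zero, Complex.exp_zero, one_mul, sub_zero] at hmv
  set e := Real.exp (-(δ / 12 * ρ ^ 2 * t)) with he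
  have he0 : 0 < e := Real.exp_pos _
  have hme : ‖cexp (μ * t)‖ * ‖cexp (-(μ * t)) * (w t + α * z t) - (w 0 + α * z 0)‖ ≤
      3 / δ * |ρ| * e * D := by
    refine (mul_le_mul_of_nonneg_left hmv (norm_nonneg _)).trans ?_
    rw [hexp]
    have e4 : Real.exp (-(ρ ^ 2 / 2 * t)) * Real.exp ((1 / 2 - δ / 6) * ρ ^ 2 * t) = e * e := by
      rw [he, ← Real.exp_add, ← Real.exp_add]; congr 1; ring
    -- Half of the available decay `e * e` is spent on `ρ²t`, which lowers the cubic error to first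
    -- order.
    have e5 : ρ ^ 2 * t * e ≤ 12 / δ := by
      have h1 : δ / 12 * ρ ^ 2 * t * e ≤ 1 := by
        rw [he, Real.exp_neg, ← div_eq_mul_inv, div_le_one (Real.exp_pos _)]
        linarith [Real.add_one_le_exp (δ / 12 * ρ ^ 2 * t)]
      rw [le_div_iff₀ hδ]
      linarith
    calc _ = (Real.exp (-(ρ ^ 2 / 2 * t)) * Real.exp ((1 / 2 - δ / 6) * ρ ^ 2 * t)) *
          (|ρ| ^ 3 / 4 * D * t) := by ring
      _ = (ρ ^ 2 * t * e) * (|ρ| * e * D / 4) := by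
        rw [e4, ← sq_abs ρ]; ring
      _ ≤ 12 / δ * (|ρ| * e * D / 4) := by gcongr
      _ = _ := by ring
  have hdecomp : w t - cexp (μ * t) * w 0 =
      cexp (μ * t) * (cexp (-(μ * t)) * (w t + α * z t) - (w 0 + α * z 0)) - α * z t +
        α * (cexp (μ * t) * z 0) := by
    have : cexp (μ * t) * cexp (-(μ * t)) = 1 := by rw [← Complex.exp_add]; simp
    linear_combination -(w t + α * z t) * this
  have hz := h.swap.norm_le hδ (by simpa using hδρ) ht
  rw [neg_sq, add_comm ‖z 0‖] at hz
  have hle1 : Real.exp (-(δ / 6 * ρ ^ 2 * t)) ≤ e := by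
    rw [he]; gcongr; linarith
  have hle2 : Real.exp (-(ρ ^ 2 / 2 * t)) ≤ e := by
    rw [he, Real.exp_le_exp]
    nlinarith [mul_nonneg (sq_nonneg ρ) ht]
  have hz0 : ‖z 0‖ ≤ D := by rw [hD]; linarith [norm_nonneg (w 0)]
  rw [hdecomp]
  calc _ ≤ 3 / δ * |ρ| * e * D + |ρ| / 4 * (2 * e * D) + |ρ| / 4 * (e * D) := by
        refine (norm_add_le _ _).trans (add_le_add ((_root_.norm_sub_le _ _).trans (add_le_add ?_ ?_)) ?_)
        · rw [norm_mul]; exact hme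
        · rw [norm_mul, hαn]
          gcongr
          exact hz.trans (by gcongr)
        · rw [norm_mul, norm_mul, hαn, hexp]
          gcongr
    _ ≤ _ := by
      have : 0 ≤ |ρ| * e * D := by positivity
      nlinarith

end Pair

/-! ### Linear flows and uniqueness on the half-line. -/

section Flow

variable {E : Type*} [NormedAddCommGroup E] [NormedSpace ℂ E]

/-- The flow `exp (t G)` of the linear equation `w' = G w`. -/
noncomputable def flow (t : ℝ) (G : E →L[ℂ] E) : E →L[ℂ] E := NormedSpace.exp (t • G)

theorem flow_zero (G : E →L[ℂ] E) (v : E) : flow 0 G v = v := by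
  simp [flow]

theorem continuous_flow [CompleteSpace E] (t : ℝ) : Continuous (flow (E := E) t) := by
  let _ : NormedAlgebra ℚ (E →L[ℂ] E) := NormedAlgebra.restrictScalars ℚ ℂ _
  exact NormedSpace.exp_continuous.comp (continuous_const_smul t)

theorem hasDerivAt_flow [CompleteSpace E] (G : E →L[ℂ] E) (t : ℝ) :
    HasDerivAt (fun t => flow t G) (G * flow t G) t :=
  hasDerivAt_exp_smul_const' (𝕂 := ℝ) G t

theorem hasDerivAt_flow_neg [CompleteSpace E] (G : E →L[ℂ] E) (t : ℝ) :
    HasDerivAt (fun t => flow (-t) G) (-(flow (-t) G * G)) t := by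
  have := (hasDerivAt_exp_smul_const (𝕂 := ℝ) G (-t)).scomp t (hasDerivAt_neg t)
  rw [neg_one_smul] at this
  exact this

theorem flow_mul_flow_neg [CompleteSpace E] (G : E →L[ℂ] E) (t : ℝ) : flow t G * flow (-t) G = 1 := by
  let _ : NormedAlgebra ℚ (E →L[ℂ] E) := NormedAlgebra.restrictScalars ℚ ℂ _
  unfold flow
  rw [neg_smul, ← NormedSpace.exp_add_of_commute (Commute.neg_right (Commute.refl _))]
  simp

theorem hasDerivAt_clm_apply {T : ℝ → E →L[ℂ] E} {T' : E →L[ℂ] E} {w : ℝ → E} {w' : E} {t : ℝ}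
    (hT : HasDerivAt T T' t) (hw : HasDerivAt w w' t) :
    HasDerivAt (fun t => T t (w t)) (T' (w t) + T t w') t := by
  have h := ((ContinuousLinearMap.restrictScalarsL ℂ E E ℝ ℝ).hasFDerivAt.comp_hasDerivAt t hT)
  exact h.clm_apply hw

theorem hasDerivAt_flow_apply [CompleteSpace E] (G : E →L[ℂ] E) (v : E) (t : ℝ) :
    HasDerivAt (fun t => flow t G v) (G (flow t G v)) t :=
  (hasDerivAt_clm_apply (hasDerivAt_flow G t) (hasDerivAt_const t v)).congr_deriv (by simp)

/-- Uniqueness for the Cauchy problem `w' = G w` on the half-line. -/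
theorem eq_flow [CompleteSpace E] {G : E →L[ℂ] E} {w : ℝ → E} (hc : ContinuousOn w (Set.Ici 0))
    (hw : ∀ t, 0 < t → HasDerivAt w (G (w t)) t) {t : ℝ} (ht : 0 ≤ t) :
    w t = flow t G (w 0) := by
  set g : ℝ → E := fun t => flow (-t) G (w t) with hg
  have hgd : ∀ t, 0 < t → HasDerivAt g 0 t := fun t ht =>
    (hasDerivAt_clm_apply (hasDerivAt_flow_neg G t) (hw t ht)).congr_deriv (by simp)
  have hcE : Continuous (fun t : ℝ => flow (-t) G) :=
    continuous_iff_continuousAt.2 fun t => (hasDerivAt_flow_neg G t).continuousAt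
  have hgc : ContinuousOn g (Set.Ici 0) := hcE.continuousOn.clm_apply hc
  -- The equation is known only for positive times, so `g` is constant on `(0, t]` and its value at
  -- `0` comes from one-sided continuity.
  have hg0 : g t = g 0 := by
    rcases ht.eq_or_lt with rfl | ht
    · rfl
    have hconst : ∀ s ∈ Set.Ioc 0 t, g s = g t := fun s hs => by
      refine ((constant_of_has_deriv_right_zero (hgc.mono fun x hx => hs.1.le.trans hx.1)
        (fun x hx => (hgd x (hs.1.trans_le hx.1)).hasDerivWithinAt)) t
        (Set.right_mem_Icc.2 hs.2)).symm
    have h1 : Filter.Tendsto g (nhdsWithin 0 (Set.Ioi 0)) (nhds (g 0)) :=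
      (hgc 0 Set.self_mem_Ici).mono_left (nhdsWithin_mono _ Set.Ioi_subset_Ici_self)
    have h2 : Filter.Tendsto g (nhdsWithin 0 (Set.Ioi 0)) (nhds (g t)) :=
      tendsto_const_nhds.congr' (by
        filter_upwards [Ioc_mem_nhdsGT ht] with s hs using (hconst s hs).symm)
    exact tendsto_nhds_unique h2 h1
  have h4 : flow t G (g t) = w t := by
    have := congrArg (fun T : E →L[ℂ] E => T (w t)) (flow_mul_flow_neg G t)
    simpa using this
  rw [← h4, hg0, hg]
  simp [flow_zero]

end Flow

/-! ### The propagator and its diagonal approximation. -/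

section Propagator

/-- The generator `i r B₁ - ½ r² B₀` at the frequency modulus `r`. -/
noncomputable def generator (a b r : ℝ) : C4 →L[ℂ] C4 :=
  (I * r) • Matrix.toEuclideanCLM (𝕜 := ℂ) (B1 a b) -
    ((1 / 2 : ℂ) * (r : ℂ) ^ 2) • Matrix.toEuclideanCLM (𝕜 := ℂ) (B0 a b)

/-- The propagator `exp (t (i r B₁ - ½ r² B₀))`. -/
noncomputable def propagator (a b t r : ℝ) : C4 →L[ℂ] C4 := flow t (generator a b r)

theorem generator_apply (a b r : ℝ) (w : C4) :
    generator a b r w =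
      (I * r) • act (B1 a b) w - ((1 / 2 : ℂ) * (r : ℂ) ^ 2) • act (B0 a b) w := rfl

theorem propagator_zero (a b r : ℝ) (v : C4) : propagator a b 0 r v = v := flow_zero _ v

theorem continuous_propagator (a b t : ℝ) : Continuous (propagator a b t) := by
  refine (continuous_flow t).comp ?_
  unfold generator
  fun_prop

theorem hasDerivAt_propagator_coord (a b r : ℝ) (v : C4) (t : ℝ) (i : Fin 4) :
    HasDerivAt (fun t => propagator a b t r v i)
      (generator a b r (propagator a b t r v) i) t :=
  (PiLp.proj (𝕜 := ℝ) 2 (fun _ : Fin 4 => ℂ) i).hasFDerivAt.comp_hasDerivAt t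
    (hasDerivAt_flow_apply (generator a b r) v t)

theorem isHalfWavePair_propagator_fst (a b r : ℝ) (v : C4) :
    IsHalfWavePair (b * r) (fun t => propagator a b t r v 0) (fun t => propagator a b t r v 2) := by
  intro t
  refine ⟨(hasDerivAt_propagator_coord a b r v t 0).congr_deriv ?_,
    (hasDerivAt_propagator_coord a b r v t 2).congr_deriv ?_⟩ <;>
  · simp [generator_apply, act, B0, B1, Matrix.mulVec, dotProduct, Fin.sum_univ_four,
      Matrix.diagonal_apply]
    ring

theorem isHalfWavePair_propagator_snd (a b r : ℝ) (v : C4) :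
    IsHalfWavePair (a * r) (fun t => propagator a b t r v 1) (fun t => propagator a b t r v 3) := by
  intro t
  refine ⟨(hasDerivAt_propagator_coord a b r v t 1).congr_deriv ?_,
    (hasDerivAt_propagator_coord a b r v t 3).congr_deriv ?_⟩ <;>
  · simp [generator_apply, act, B0, B1, Matrix.mulVec, dotProduct, Fin.sum_univ_four,
      Matrix.diagonal_apply]
    ring

theorem norm_le_sum_coord (x : C4) : ‖x‖ ≤ ∑ i, ‖x i‖ := by
  conv_lhs => rw [← (EuclideanSpace.basisFun (Fin 4) ℂ).sum_repr x]
  refine (norm_sum_le _ _).trans (le_of_eq ?_)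
  simp [norm_smul]

/-- The propagator differs from its diagonal approximation by `O(|ξ| e^{-κ|ξ|²t})`. -/
theorem exists_norm_propagator_sub_le {a b ε : ℝ} (ha : 0 < a) (hab : a < b) :
    ∃ K κ : ℝ, 0 < K ∧ 0 < κ ∧ ∀ (t : ℝ) (ξ : Plane) (v : C4), 0 ≤ t → ‖ξ‖ < ε →
      ‖propagator a b t ‖ξ‖ v - act (S0 a b t ξ) v‖ ≤
        K * ‖ξ‖ * Real.exp (-(κ * ‖ξ‖ ^ 2 * t)) * ‖v‖ := by
  have hb : 0 < b := ha.trans hab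
  -- This makes `δ(1 + ρ²) ≤ 1` for every `|ρ| ≤ bε`, uniformly over the low frequencies; the slower
  -- speed `a` fixes the decay rate.
  set δ : ℝ := (1 + (b * ε) ^ 2)⁻¹ with hδ
  have hδ0 : 0 < δ := by positivity
  refine ⟨4 * ((3 / δ + 1) * b * 2), δ / 12 * a ^ 2, by positivity, by positivity,
    fun t ξ v ht hξ => ?_⟩
  set r := ‖ξ‖ with hr
  have hr0 : 0 ≤ r := norm_nonneg _
  have key : ∀ (ρ : ℝ) (w z : ℝ → ℂ) (i j : Fin 4), a * r ≤ |ρ| → |ρ| ≤ b * r →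
      IsHalfWavePair ρ w z → w 0 = v i → z 0 = v j →
      ‖w t - cexp ((I * ρ - ρ ^ 2 / 2) * t) * v i‖ ≤
        (3 / δ + 1) * b * 2 * r * Real.exp (-(δ / 12 * a ^ 2 * r ^ 2 * t)) * ‖v‖ := by
    intro ρ w z i j h1 h2 h hi hj
    have hρ1 : (a * r) ^ 2 ≤ ρ ^ 2 := by
      rw [← sq_abs ρ]; exact pow_le_pow_left₀ (by positivity) h1 2
    have hρ2 : ρ ^ 2 ≤ (b * ε) ^ 2 := by
      rw [← sq_abs ρ]
      exact pow_le_pow_left₀ (abs_nonneg _) (h2.trans (by gcongr)) 2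
    have hδρ : δ * (1 + ρ ^ 2) ≤ 1 := by
      rw [hδ, inv_mul_le_iff₀ (by positivity)]; linarith
    have h3 := h.norm_sub_le hδ0 hδρ ht
    rw [hi, hj] at h3
    refine h3.trans ?_
    have h4 : ‖v i‖ + ‖v j‖ ≤ 2 * ‖v‖ := by
      linarith [PiLp.norm_apply_le v i, PiLp.norm_apply_le v j]
    calc _ ≤ (3 / δ + 1) * (b * r) * Real.exp (-(δ / 12 * a ^ 2 * r ^ 2 * t)) * (2 * ‖v‖) := by
          gcongr (3 / δ + 1) * ?_ * Real.exp ?_ * ?_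
          rw [neg_le_neg_iff]
          have : δ / 12 * a ^ 2 * r ^ 2 = δ / 12 * (a * r) ^ 2 := by ring
          rw [this]
          gcongr
      _ = _ := by ring
  have hbr : |b * r| = b * r := abs_of_nonneg (by positivity)
  have har : |a * r| = a * r := abs_of_nonneg (by positivity)
  have hle : a * r ≤ b * r := by gcongr
  have p1 := isHalfWavePair_propagator_fst a b r v
  have p2 := isHalfWavePair_propagator_snd a b r v
  have k0 := key _ _ _ 0 2 (by rw [hbr]; exact hle) hbr.le p1 (by simp [propagator_zero])
    (by simp [propagator_zero])
  have k2 := key _ _ _ 2 0 (by rw [abs_neg, hbr]; exact hle) (by rw [abs_neg, hbr]) p1.swap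
    (by simp [propagator_zero]) (by simp [propagator_zero])
  have k1 := key _ _ _ 1 3 har.ge (by rw [har]; exact hle) p2 (by simp [propagator_zero])
    (by simp [propagator_zero])
  have k3 := key _ _ _ 3 1 (by rw [abs_neg, har]) (by rw [abs_neg, har]; exact hle) p2.swap
    (by simp [propagator_zero]) (by simp [propagator_zero])
  refine (norm_le_sum_coord _).trans ?_
  have hcoord : ∀ i, (act (S0 a b t ξ) v) i = S0 a b t ξ i i * v i := fun i => by
    simp [act, S0, Matrix.mulVec_diagonal]
  simp only [PiLp.sub_apply, hcoord, Fin.sum_univ_four]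
  have e0 : S0 a b t ξ 0 0 = cexp ((I * ((b * r : ℝ) : ℂ) - ((b * r : ℝ) : ℂ) ^ 2 / 2) * t) := by
    simp only [S0, Matrix.diagonal_apply_eq, Matrix.cons_val]
    congr 1; push_cast; ring
  have e1 : S0 a b t ξ 1 1 = cexp ((I * ((a * r : ℝ) : ℂ) - ((a * r : ℝ) : ℂ) ^ 2 / 2) * t) := by
    simp only [S0, Matrix.diagonal_apply_eq, Matrix.cons_val]
    congr 1; push_cast; ring
  have e2 : S0 a b t ξ 2 2 =
      cexp ((I * ((-(b * r) : ℝ) : ℂ) - ((-(b * r) : ℝ) : ℂ) ^ 2 / 2) * t) := by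
    simp only [S0, Matrix.diagonal_apply_eq, Matrix.cons_val]
    congr 1; push_cast; ring
  have e3 : S0 a b t ξ 3 3 =
      cexp ((I * ((-(a * r) : ℝ) : ℂ) - ((-(a * r) : ℝ) : ℂ) ^ 2 / 2) * t) := by
    simp only [S0, Matrix.diagonal_apply_eq, Matrix.cons_val]
    congr 1; push_cast; ring
  rw [e0, e1, e2, e3]
  linarith

end Propagator

/-! ### Trading powers of the frequency for time decay. -/

section Decay

/-- With `y = (1+t)r²` one has `r^σ = y^{σ/2}(1+t)^{-σ/2}`, and half of the exponential absorbs
`y^{σ/2}`. Replacing `t` by `1+t` costs `e^{κε²}`, finite because `r < ε`. -/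
theorem exists_rpow_mul_exp_le {σ κ : ℝ} (hσ : 0 < σ) (hκ : 0 < κ) (ε : ℝ) :
    ∃ C : ℝ, 0 < C ∧ ∀ r t : ℝ, 0 ≤ r → r < ε → 0 ≤ t →
      r ^ σ * Real.exp (-(κ * r ^ 2 * t)) ≤
        C * (1 + t) ^ (-(σ / 2)) * Real.exp (-(κ / 2 * (1 + t)) * r ^ 2) := by
  set c : ℝ := κ / σ with hc
  have hc0 : 0 < c := by positivity
  refine ⟨c⁻¹ ^ (σ / 2) * Real.exp (κ * ε ^ 2), by positivity, fun r t hr hrε ht => ?_⟩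
  have ht1 : 0 < 1 + t := by linarith
  set y : ℝ := (1 + t) * r ^ 2 with hy
  have hy0 : 0 ≤ y := by positivity
  have h1 : y ≤ c⁻¹ * Real.exp (c * y) := by
    rw [le_inv_mul_iff₀ hc0]
    linarith [Real.add_one_le_exp (c * y)]
  have h2 : y ^ (σ / 2) ≤ c⁻¹ ^ (σ / 2) * Real.exp (κ / 2 * y) := by
    refine (Real.rpow_le_rpow hy0 h1 (by positivity)).trans (le_of_eq ?_)
    rw [Real.mul_rpow (by positivity) (by positivity), ← Real.exp_mul]
    congr 2
    rw [hc]; field_simp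
  have h3 : r ^ σ = y ^ (σ / 2) * (1 + t) ^ (-(σ / 2)) := by
    rw [hy, Real.mul_rpow ht1.le (by positivity), Real.rpow_neg ht1.le, ← Real.rpow_natCast r 2,
      ← Real.rpow_mul hr]
    have : ((2 : ℕ) : ℝ) * (σ / 2) = σ := by push_cast; ring
    rw [this]; field_simp
  have h4 : Real.exp (-(κ * r ^ 2 * t)) ≤ Real.exp (κ * ε ^ 2) * Real.exp (-(κ * y)) := by
    rw [← Real.exp_add, Real.exp_le_exp, hy]
    have : r ^ 2 ≤ ε ^ 2 := by gcongr
    nlinarith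
  calc r ^ σ * Real.exp (-(κ * r ^ 2 * t))
      ≤ (c⁻¹ ^ (σ / 2) * Real.exp (κ / 2 * y) * (1 + t) ^ (-(σ / 2))) *
        (Real.exp (κ * ε ^ 2) * Real.exp (-(κ * y))) := by rw [h3]; gcongr
    _ = c⁻¹ ^ (σ / 2) * Real.exp (κ * ε ^ 2) * (1 + t) ^ (-(σ / 2)) *
        (Real.exp (κ / 2 * y) * Real.exp (-(κ * y))) := by ring
    _ = _ := by
      rw [← Real.exp_add, hy]
      congr 2; ring

theorem integral_plane_exp_neg_mul_sq {c : ℝ} (hc : 0 < c) :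
    ∫ ξ : Plane, Real.exp (-c * ‖ξ‖ ^ 2) = Real.pi / c := by
  rw [GaussianFourier.integral_rexp_neg_mul_sq_norm hc, finrank_euclideanSpace_fin]
  norm_num

theorem integrable_plane_exp_neg_mul_sq {c : ℝ} (hc : 0 < c) :
    Integrable fun ξ : Plane => Real.exp (-c * ‖ξ‖ ^ 2) := by
  refine Integrable.of_integral_ne_zero ?_
  rw [integral_plane_exp_neg_mul_sq hc]
  positivity

end Decay

/-! ### Sup and `L¹` bounds for the low-frequency symbol. -/

section Symbol

/-- The operator `e^{tG(ξ)} - Ŝ₀(t, ξ)` on `ℂ⁴`. -/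
noncomputable def diffOp (a b t : ℝ) (ξ : Plane) : C4 →L[ℂ] C4 :=
  propagator a b t ‖ξ‖ - Matrix.toEuclideanCLM (𝕜 := ℂ) (S0 a b t ξ)

theorem diffOp_apply (a b t : ℝ) (ξ : Plane) (v : C4) :
    diffOp a b t ξ v = propagator a b t ‖ξ‖ v - act (S0 a b t ξ) v := rfl

/-- The symbol `|ξ|^s χ(ξ) (e^{tG(ξ)} - Ŝ₀(t, ξ))` applied to a vector field. -/
noncomputable def diffSymbol (a b s t : ℝ) (χ : Plane → ℝ) (v : Plane → C4) (ξ : Plane) : C4 :=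
  (‖ξ‖ ^ s * χ ξ) • diffOp a b t ξ (v ξ)

theorem continuous_S0 (a b t : ℝ) : Continuous (S0 a b t) := by
  unfold S0
  refine Continuous.matrix_diagonal (continuous_pi fun i => ?_)
  fin_cases i <;> simp <;> fun_prop

theorem continuous_diffOp (a b t : ℝ) : Continuous (diffOp a b t) := by
  have h : Continuous (Matrix.toEuclideanCLM (n := Fin 4) (𝕜 := ℂ)) :=
    LinearMap.continuous_of_finiteDimensional
      (Matrix.toEuclideanCLM (n := Fin 4) (𝕜 := ℂ)).toAlgEquiv.toLinearMap
  exact ((continuous_propagator a b t).comp continuous_norm).sub (h.comp (continuous_S0 a b t))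

theorem measurable_smul_clm_apply {E : Type*} [NormedAddCommGroup E] [NormedSpace ℂ E]
    [MeasurableSpace E] [BorelSpace E] [SecondCountableTopology E] {f : Plane → ℝ}
    (hf : Measurable f) {T : Plane → E →L[ℂ] E} (hT : Continuous T) {v : Plane → E}
    (hv : Measurable v) : Measurable fun ξ => f ξ • T ξ (v ξ) := by
  have h : Continuous fun p : Plane × E => T p.1 p.2 := (hT.comp continuous_fst).clm_apply
    continuous_snd
  exact hf.smul (h.measurable.comp (measurable_id.prodMk hv))

theorem measurable_diffSymbol (a b s t : ℝ) {χ : Plane → ℝ}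
    (hχ : Continuous χ) {v : Plane → C4} (hv : Measurable v) :
    Measurable (diffSymbol a b s t χ v) :=
  measurable_smul_clm_apply ((measurable_norm.pow_const s).mul hχ.measurable)
    (continuous_diffOp a b t) hv

/-- Decay of the low-frequency symbol in `L^∞` and `L¹`. -/
theorem exists_diffSymbol_le {a b ε : ℝ} (ha : 0 < a) (hab : a < b) {χ : Plane → ℝ}
    (hχ : Continuous χ) (hχε : Function.support χ ⊆ {ξ : Plane | ‖ξ‖ < ε})
    {s : ℝ} (hs : 0 ≤ s) {Q : ℝ} (hQ : 0 < Q) :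
    ∃ K : ℝ, 0 < K ∧ ∀ (t : ℝ) (v : Plane → C4), 0 ≤ t → Measurable v → (∀ ξ, ‖v ξ‖ ≤ Q) →
      Integrable (diffSymbol a b s t χ v) ∧
      ∫⁻ ξ, ‖diffSymbol a b s t χ v ξ‖ₑ ≤ ENNReal.ofReal (K * (1 + t) ^ (-((s + 1) / 2) - 1)) ∧
      ∀ ξ, ‖diffSymbol a b s t χ v ξ‖ ≤ K * (1 + t) ^ (-((s + 1) / 2)) := by
  obtain ⟨X, hX⟩ := hχ.bounded_above_of_compact_support
    (HasCompactSupport.of_support_subset_isCompact (isCompact_closedBall (0 : Plane) ε)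
      fun ξ hξ => by simpa using (show ‖ξ‖ < ε from hχε hξ).le)
  have hX0 : 0 ≤ X := (norm_nonneg _).trans (hX 0)
  obtain ⟨K, κ, hK, hκ, hdiff⟩ := exists_norm_propagator_sub_le (ε := ε) ha hab
  -- The exponent is `s + 1`: the weight gives `s`, the error of the diagonal approximation one
  -- more.
  obtain ⟨C, hC, hdecay⟩ := exists_rpow_mul_exp_le (show 0 < s + 1 by linarith) hκ ε
  set B := (X + 1) * K * Q * C with hB
  have hB0 : 0 < B := by positivity
  have hpt : ∀ (t : ℝ) (v : Plane → C4), 0 ≤ t → (∀ ξ, ‖v ξ‖ ≤ Q) → ∀ ξ,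
      ‖diffSymbol a b s t χ v ξ‖ ≤
        B * (1 + t) ^ (-((s + 1) / 2)) * Real.exp (-(κ / 2 * (1 + t)) * ‖ξ‖ ^ 2) := by
    intro t v ht hv ξ
    have ht1 : 0 < 1 + t := by linarith
    by_cases hξ : χ ξ = 0
    · rw [diffSymbol, hξ, mul_zero, zero_smul, norm_zero]; positivity
    have hξε : ‖ξ‖ < ε := hχε hξ
    rw [diffSymbol, norm_smul, norm_mul, Real.norm_of_nonneg (by positivity), mul_assoc,
      diffOp_apply]
    have h1 := hdecay ‖ξ‖ t (norm_nonneg _) hξε ht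
    have h2 : ‖ξ‖ ^ (s + 1) = ‖ξ‖ ^ s * ‖ξ‖ := by
      rw [Real.rpow_add_of_nonneg (norm_nonneg _) hs zero_le_one, Real.rpow_one]
    calc ‖ξ‖ ^ s * (‖χ ξ‖ * ‖propagator a b t ‖ξ‖ (v ξ) - act (S0 a b t ξ) (v ξ)‖)
        ≤ ‖ξ‖ ^ s * ((X + 1) * (K * ‖ξ‖ * Real.exp (-(κ * ‖ξ‖ ^ 2 * t)) * Q)) := by
          gcongr
          · linarith [hX ξ]
          · refine (hdiff t ξ (v ξ) ht hξε).trans ?_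
            gcongr
            exact hv ξ
      _ = (X + 1) * K * Q * (‖ξ‖ ^ (s + 1) * Real.exp (-(κ * ‖ξ‖ ^ 2 * t))) := by rw [h2]; ring
      _ ≤ (X + 1) * K * Q *
          (C * (1 + t) ^ (-((s + 1) / 2)) * Real.exp (-(κ / 2 * (1 + t)) * ‖ξ‖ ^ 2)) := by gcongr
      _ = _ := by rw [hB]; ring
  -- The summand `1` serves the sup bound, and `2π/κ` comes from the Gaussian integral `π /
  -- (κ(1+t)/2)`.
  refine ⟨B * (1 + 2 * Real.pi / κ), by positivity, fun t v ht hvm hv => ?_⟩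
  have ht1 : 0 < 1 + t := by linarith
  have hc : 0 < κ / 2 * (1 + t) := by positivity
  have hBK : B ≤ B * (1 + 2 * Real.pi / κ) := le_mul_of_one_le_right hB0.le (by
    have : 0 < 2 * Real.pi / κ := by positivity
    linarith)
  have hgi := (integrable_plane_exp_neg_mul_sq hc).const_mul (B * (1 + t) ^ (-((s + 1) / 2)))
  refine ⟨hgi.mono' (measurable_diffSymbol a b s t hχ hvm).aestronglyMeasurable
    (.of_forall (hpt t v ht hv)), ?_, fun ξ => ?_⟩
  · calc ∫⁻ ξ, ‖diffSymbol a b s t χ v ξ‖ₑ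
        ≤ ∫⁻ ξ : Plane, ENNReal.ofReal (B * (1 + t) ^ (-((s + 1) / 2)) *
          Real.exp (-(κ / 2 * (1 + t)) * ‖ξ‖ ^ 2)) := by
          refine lintegral_mono fun ξ => ?_
          rw [← ofReal_norm]
          exact ENNReal.ofReal_le_ofReal (hpt t v ht hv ξ)
      _ = ENNReal.ofReal (B * (1 + t) ^ (-((s + 1) / 2)) * (Real.pi / (κ / 2 * (1 + t)))) := by
          rw [← ofReal_integral_eq_lintegral_ofReal hgi (.of_forall fun ξ => by positivity),
            integral_const_mul, integral_plane_exp_neg_mul_sq hc]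
      _ ≤ _ := by
          refine ENNReal.ofReal_le_ofReal ?_
          rw [Real.rpow_sub_one ht1.ne']
          have : B * (1 + t) ^ (-((s + 1) / 2)) * (Real.pi / (κ / 2 * (1 + t))) =
              B * (2 * Real.pi / κ) * ((1 + t) ^ (-((s + 1) / 2)) / (1 + t)) := by
            field_simp
          rw [this]
          gcongr
          linarith
  · refine (hpt t v ht hv ξ).trans ?_
    have : Real.exp (-(κ / 2 * (1 + t)) * ‖ξ‖ ^ 2) ≤ 1 := by
      rw [Real.exp_le_one_iff]
      nlinarith [mul_nonneg hc.le (sq_nonneg ‖ξ‖)]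
    calc _ ≤ B * (1 + t) ^ (-((s + 1) / 2)) * 1 := by gcongr
      _ ≤ _ := by rw [mul_one]; gcongr

end Symbol

/-! ### The initial vector in terms of the four scalar data. -/

section Data

/-- The coefficients of the four scalar data in `W₀`: the entries `inl k` belong to `|D| u₀⁽ᵏ⁾`,
the entries `inr k` to `u₁⁽ᵏ⁾`. -/
noncomputable def dataVec (a b : ℝ) (η : Plane) : Fin 2 ⊕ Fin 2 → C4
  | .inl k => !₂[I * b * M η 0 k, I * a * M η 1 k, -(I * b * M η 0 k), -(I * a * M η 1 k)]
  | .inr k => !₂[M η 0 k, M η 1 k, M η 0 k, M η 1 k]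

theorem norm_M_le {η : Plane} (hη : ‖η‖ ≤ 1) (i j : Fin 2) : ‖M η i j‖ ≤ 1 := by
  have h : ∀ k, |η k| ≤ 1 := fun k => (PiLp.norm_apply_le η k).trans hη
  fin_cases i <;> fin_cases j <;> simp [M, h]

theorem norm_dataVec_le {a b : ℝ} (ha : 0 < a) (hab : a < b) {η : Plane} (hη : ‖η‖ ≤ 1)
    (i : Fin 2 ⊕ Fin 2) : ‖dataVec a b η i‖ ≤ 4 * (1 + b) := by
  have hb : 0 < b := ha.trans hab
  refine (norm_le_sum_coord _).trans ?_
  rw [Fin.sum_univ_four]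
  rcases i with k | k
  · have h0 := norm_M_le hη 0 k
    have h1 := norm_M_le hη 1 k
    simp only [dataVec, PiLp.toLp_apply, Matrix.cons_val, norm_neg, norm_mul, norm_I, one_mul,
      Complex.norm_real, Real.norm_of_nonneg ha.le, Real.norm_of_nonneg hb.le]
    nlinarith
  · have h0 := norm_M_le hη 0 k
    have h1 := norm_M_le hη 1 k
    simp only [dataVec, PiLp.toLp_apply, Matrix.cons_val]
    linarith

theorem continuous_dataVec (a b : ℝ) (i : Fin 2 ⊕ Fin 2) : Continuous fun η => dataVec a b η i := by
  have hM : ∀ i j, Continuous fun η => M η i j := fun i j => by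
    fin_cases i <;> fin_cases j <;> simp [M] <;> fun_prop
  rcases i with k | k
  · have h0 := hM 0 k
    have h1 := hM 1 k
    refine (PiLp.continuous_toLp 2 _).comp (continuous_pi fun j => ?_)
    fin_cases j <;> simp <;> fun_prop
  · have h0 := hM 0 k
    have h1 := hM 1 k
    refine (PiLp.continuous_toLp 2 _).comp (continuous_pi fun j => ?_)
    fin_cases j <;> simp <;> fun_prop

/-- The vector field `ξ ↦ dataVec (ξ / |ξ|)`. -/
noncomputable def dataField (a b : ℝ) (i : Fin 2 ⊕ Fin 2) (ξ : Plane) : C4 :=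
  dataVec a b (‖ξ‖⁻¹ • ξ) i

theorem measurable_dataField (a b : ℝ) (i : Fin 2 ⊕ Fin 2) : Measurable (dataField a b i) :=
  (continuous_dataVec a b i).measurable.comp (measurable_norm.inv.smul measurable_id)

theorem norm_dataField_le {a b : ℝ} (ha : 0 < a) (hab : a < b) (i : Fin 2 ⊕ Fin 2) (ξ : Plane) :
    ‖dataField a b i ξ‖ ≤ 4 * (1 + b) := by
  refine norm_dataVec_le ha hab ?_ i
  rw [norm_smul, norm_inv, norm_norm]
  -- At the origin the direction is `0` by convention, hence a bound by `1` and not an equality.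
  exact inv_mul_le_one

/-- On the unit circle `M η` is the matrix of a reflection, hence an involution. -/
theorem inv_M {η : Plane} (hη : ‖η‖ = 1) : (M η)⁻¹ = M η := by
  refine Matrix.inv_eq_left_inv ?_
  have h : (η 0 : ℂ) * η 0 + η 1 * η 1 = 1 := by
    have := EuclideanSpace.real_norm_sq_eq η
    rw [hη, Fin.sum_univ_two] at this
    rw [← ofReal_mul, ← ofReal_mul, ← ofReal_add, ← ofReal_one]
    congr 1
    linarith
  ext i j
  fin_cases i <;> fin_cases j <;> simp [M, Matrix.mul_apply, Fin.sum_univ_two]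
  · exact h
  · ring
  · ring
  · linear_combination h

/-- The transform of `u₀` enters only through `|ξ|û₀`, so any singularity at the origin is absorbed
and the coefficients are bounded functions of the direction alone. -/
theorem W0_eq_sum {a b : ℝ} {uhat₀ uhat₁ : Fin 2 → Plane → ℂ} {d : Fin 2 → ℂ} {ξ : Plane}
    (hξ : ξ ≠ 0) (hd : ∀ k, (‖ξ‖ : ℂ) * uhat₀ k ξ = d k) :
    W0 a b uhat₀ uhat₁ ξ =
      ∑ i, Sum.elim d (fun k => uhat₁ k ξ) i • dataField a b i ξ := by
  have hη : ‖‖ξ‖⁻¹ • ξ‖ = 1 := by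
    rw [norm_smul, norm_inv, norm_norm, inv_mul_cancel₀ (norm_ne_zero_iff.2 hξ)]
  rw [Fintype.sum_sum_type, Fin.sum_univ_two, Fin.sum_univ_two]
  simp only [W0, changeVar, inv_M hη, dataField, dataVec, Sum.elim_inl, Sum.elim_inr, ← hd]
  ext j
  fin_cases j <;> simp [Matrix.mulVec, dotProduct, Fin.sum_univ_two] <;> ring

theorem smul_apply_sum {E ι : Type*} [NormedAddCommGroup E] [NormedSpace ℂ E] [Fintype ι]
    (T : E →L[ℂ] E) (r : ℝ) (c : ι → ℂ) (v : ι → E) :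
    r • T (∑ i, c i • v i) = ∑ i, c i • r • T (v i) := by
  simp only [map_sum, map_smul, Finset.smul_sum]
  exact Finset.sum_congr rfl fun i _ => smul_comm _ _ _

end Data

/-! ### Assembly of the estimate. -/

section Main

/-- By uniqueness for the ordinary differential equation at almost every frequency, any admissible
`W` is the explicit propagator applied to the data. -/
theorem IsSolution.eq_propagator {a b : ℝ} {Winit : Plane → C4} {W : ℝ → Plane → C4}
    (h : IsSolution a b Winit W) {t : ℝ} (ht : 0 ≤ t) :
    ∀ᵐ ξ : Plane, W t ξ = propagator a b t ‖ξ‖ (Winit ξ) := by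
  filter_upwards [h] with ξ hξ
  obtain ⟨h0, hc, hd⟩ := hξ
  rw [← h0]
  refine eq_flow (w := fun t => W t ξ) hc (fun τ hτ => ?_) ht
  obtain ⟨W', hW', he⟩ := hd τ hτ
  refine hW'.congr_deriv ?_
  rw [generator_apply]
  have h1 := sub_eq_zero.1 he
  rw [← h1, add_sub_cancel_right]

theorem ae_ne_zero_plane : ∀ᵐ ξ : Plane, ξ ≠ 0 := by
  simp [ae_iff, measure_singleton]

/-- The low-frequency difference is a sum of multipliers of the four scalar data. -/
theorem smul_lowFreqDiff_ae_eq {a b : ℝ} (χ : Plane → ℝ) (s : ℝ)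
    {u₀ : Fin 2 → 𝓢'(Plane, ℂ)} {uhat₀ : Fin 2 → Plane → ℂ} {Du₀ u₁ : Fin 2 → 𝓢(Plane, ℂ)}
    (hu : ∀ k, IsAbsD (u₀ k) (uhat₀ k) (Du₀ k)) {W : ℝ → Plane → C4}
    (hW : IsSolution a b (W0 a b uhat₀ fun k => fourier (⇑(u₁ k))) W) {t : ℝ} (ht : 0 ≤ t) :
    (fun ξ => ‖ξ‖ ^ s • lowFreqDiff a b χ (W0 a b uhat₀ fun k => fourier (⇑(u₁ k))) W t ξ)
      =ᵐ[volume] fun ξ => ∑ i, fourier (⇑(Sum.elim Du₀ u₁ i)) ξ •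
        diffSymbol a b s t χ (dataField a b i) ξ := by
  filter_upwards [hW.eq_propagator ht, ae_ne_zero_plane, ae_all_iff.2 fun k => (hu k).2]
    with ξ h1 h2 h3
  rw [lowFreqDiff, h1, ← diffOp_apply, smul_smul, W0_eq_sum h2 h3, smul_apply_sum]
  refine Finset.sum_congr rfl fun i _ => ?_
  rcases i with k | k <;> rfl

theorem fourierInv_sum_eq {ι : Type*} [Fintype ι] (F : ι → 𝓢(Plane, ℂ)) {m : ι → Plane → C4}
    (hm : ∀ i, Integrable (m i)) :
    fourierInv (fun ξ => ∑ i, fourier (⇑(F i)) ξ • m i ξ) = ∑ i, multiplier (m i) (F i) := by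
  rw [fourierInv_sum _ _ fun i _ => integrable_fourier_smul (hm i) (F i).integrable]
  funext x
  rw [Finset.sum_apply]
  rfl

end Main

end KelvinVoigt

open MeasureTheory KelvinVoigt in
theorem mainTheorem6 (a b : ℝ) (ha : 0 < a) (hab : a < b)
    (ε : ℝ) (hε : 0 < ε)
    (χ : Plane → ℝ) (hχ : ContDiff ℝ ∞ χ) (hχε : Function.support χ ⊆ {ξ : Plane | ‖ξ‖ < ε})
    (s : ℝ) (hs : 0 ≤ s) (p q : ℝ≥0∞) (hp1 : 1 ≤ p) (hp2 : p ≤ 2) (hpq : 1 / p + 1 / q = 1) :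
    ∃ C : ℝ, 0 < C ∧
      ∀ (u₀ : Fin 2 → 𝓢'(Plane, ℂ)) (uhat₀ : Fin 2 → Plane → ℂ) (Du₀ u₁ : Fin 2 → 𝓢(Plane, ℂ)),
        (∀ k, IsAbsD (u₀ k) (uhat₀ k) (Du₀ k)) →
        ∀ W : ℝ → Plane → C4,
          IsSolution a b (W0 a b uhat₀ fun k => fourier (⇑(u₁ k))) W →
          ∀ t : ℝ, 0 ≤ t →
            Integrable (lowFreqDiff a b χ (W0 a b uhat₀ fun k => fourier (⇑(u₁ k))) W t) ∧
            Integrable (fun ξ => ‖ξ‖ ^ s •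
              lowFreqDiff a b χ (W0 a b uhat₀ fun k => fourier (⇑(u₁ k))) W t ξ) ∧
            rieszNormInv s q
                (lowFreqDiff a b χ (W0 a b uhat₀ fun k => fourier (⇑(u₁ k))) W t) ≤
              ENNReal.ofReal
                  (C * (1 + t) ^ (-(1 / 2) * (s + 2 * ((1 / p).toReal - (1 / q).toReal)) - 1 / 2)) *
                ∑ k, (eLpNorm (⇑(Du₀ k)) p volume + eLpNorm (⇑(u₁ k)) p volume) := by
  have hQ : 0 < 4 * (1 + b) := by linarith
  obtain ⟨K, hK, hsym⟩ := exists_diffSymbol_le ha hab hχ.continuous hχε hs hQ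
  -- The case of weight zero yields integrability of the unweighted difference, as `‖ξ‖ ^ 0 = 1`
  -- even at the origin.
  obtain ⟨K₀, hK₀, hsym₀⟩ := exists_diffSymbol_le ha hab hχ.continuous hχε le_rfl hQ
  obtain ⟨C, hC, hmul⟩ := exists_eLpNorm_multiplier_le (V := C4) hp1 hp2 hpq
  have hq1 : 1 ≤ q := by
    rw [← ENNReal.inv_le_one, ← one_div]
    exact (le_add_self : 1 / q ≤ 1 / p + 1 / q).trans_eq hpq
  refine ⟨C * K, by positivity, fun u₀ uhat₀ Du₀ u₁ hu W hW t ht => ?_⟩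
  have ht1 : 0 < 1 + t := by linarith
  have hint : ∀ r : ℝ, (∀ i, Integrable (diffSymbol a b r t χ (dataField a b i))) →
      Integrable (fun ξ => ‖ξ‖ ^ r •
        lowFreqDiff a b χ (W0 a b uhat₀ fun k => fourier (⇑(u₁ k))) W t ξ) := fun r hr =>
    (integrable_finsetSum _ fun i _ =>
      integrable_fourier_smul (hr i) (Sum.elim Du₀ u₁ i).integrable).congr
      (smul_lowFreqDiff_ae_eq χ r hu hW ht).symm
  have hb := fun i => hsym t _ ht (measurable_dataField a b i) (norm_dataField_le ha hab i)
  have hb₀ := fun i => hsym₀ t _ ht (measurable_dataField a b i) (norm_dataField_le ha hab i)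
  refine ⟨by simpa using hint 0 fun i => (hb₀ i).1, hint s fun i => (hb i).1, ?_⟩
  rw [rieszNormInv, fourierInv_congr_ae (smul_lowFreqDiff_ae_eq χ s hu hW ht),
    fourierInv_sum_eq _ fun i => (hb i).1]
  refine (eLpNorm_sum_le (fun i _ => (continuous_multiplier (hb i).1
    (Sum.elim Du₀ u₁ i).integrable).aestronglyMeasurable) hq1).trans ?_
  set d : ℝ := (1 / p).toReal - (1 / q).toReal with hd
  -- The interpolated exponent is `-(s+1)/2 - d`, which is the claimed rate.
  have hexp : C * ((K * (1 + t) ^ (-((s + 1) / 2) - 1)) ^ d *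
      (K * (1 + t) ^ (-((s + 1) / 2))) ^ (1 - d)) =
      C * K * (1 + t) ^ (-(1 / 2) * (s + 2 * d) - 1 / 2) := by
    rw [Real.mul_rpow hK.le (by positivity), Real.mul_rpow hK.le (by positivity),
      ← Real.rpow_mul ht1.le, ← Real.rpow_mul ht1.le]
    have e1 : K ^ d * K ^ (1 - d) = K := by rw [← Real.rpow_add hK]; simp
    have e2 : (1 + t) ^ (-(1 / 2) * (s + 2 * d) - 1 / 2) =
        (1 + t) ^ ((-((s + 1) / 2) - 1) * d) * (1 + t) ^ (-((s + 1) / 2) * (1 - d)) := by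
      rw [← Real.rpow_add ht1]; congr 1; ring
    rw [e2]
    linear_combination C * ((1 + t) ^ ((-((s + 1) / 2) - 1) * d) *
      (1 + t) ^ (-((s + 1) / 2) * (1 - d))) * e1
  have hsum : ∑ k, (eLpNorm (⇑(Du₀ k)) p volume + eLpNorm (⇑(u₁ k)) p volume) =
      ∑ i, eLpNorm (⇑(Sum.elim Du₀ u₁ i)) p volume := by
    rw [Fintype.sum_sum_type, Finset.sum_add_distrib]
    rfl
  rw [hsum, Finset.mul_sum, ← hexp]
  exact Finset.sum_le_sum fun i _ => hmul _ _ _ (hb i).1 (by positivity) (by positivity)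
    (hb i).2.1 (hb i).2.2 _
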